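/- Let $\mathbb C_{\rm cut}=\mathbb C\setminus((-\infty,0]\cup[1,\infty))$, and let $\overline{\mathbb C}_{\rm cut}$ be obtained from it by adding two boundary points $x\pm 0i=\lim_{t\searrow0}(x\pm ti)$ for each real $x\in(-\infty,0)\cup(1,\infty)$. The principal branches of $\operatorname{Log} z$, $\operatorname{Log}(1-z)$ and $\operatorname{Li}_2(z)=-\int_0^z\operatorname{Log}(1-t)\,\frac{dt}t$ are extended to $\overline{\mathbb C}_{\rm cut}$ by their one-sided limits. Let $\widehat{\mathbb C}$ (the universal abelian cover of $\mathbb C\setminus\{0,1\}$) be the quotient of $\overline{\mathbb C}_{\rm cut}\times(2\mathbb Z)^2$ by the identifications, for all $p,q\in\mathbb Z$, $$(x+0i,2p,2q)\sim(x-0i,2p+2,2q)\ \ (x<0),\qquad (x+0i,2p,2q)\sim(x-0i,2p,2q+2)\ \ (x>1),$$ with projection $\hat\pi\colon\widehat{\mathbb C}\to\mathbb C\setminus\{0,1\}$ and the complex structure for which $\hat\pi$ is locally biholomorphic; the class of $(z,2p,2q)$ is denoted $(z;2p,2q)$. Put $$FT=\Bigl\{\Bigl(x,y,\tfrac yx,\tfrac{1-1/x}{1-1/y},\tfrac{1-x}{1-y}\Bigr)\Bigm|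 x\neq y\in\mathbb C\setminus\{0,1\}\Bigr\},\qquad FT^+=\{(z_0,\dots,z_4)\in FT\mid \operatorname{Im}z_k>0 \text{ for all } k\},$$ and let $\widehat{FT}$ be the connected component of $\hat\pi^{-1}(FT)\subset\widehat{\mathbb C}^5$ that contains all $((z_0;0,0),\dots,(z_4;0,0))$ with $(z_0,\dots,z_4)\in FT^+$. Let $\hat\rho\colon\mathbb Z[\widehat{FT}]\to\mathbb Z[\widehat{\mathbb C}]$ and $\hat\nu\colon\mathbb Z[\widehat{\mathbb C}]\to\mathbb C\wedge_{\mathbb Z}\mathbb C$ be the homomorphisms given on generators by $$\hat\rho([\hat z_0,\dots,\hat z_4])=\sum_{k=0}^4(-1)^k[\hat z_k],\qquad \hat\nu([z;2p,2q])=(\operatorname{Log}z+2\pi ip)\wedge(-\operatorname{Log}(1-z)+2\pi iq),$$ and let $\widehat{\mathcal P}(\mathbb C)=\mathbb Z[\widehat{\mathbb C}]/\operatorname{im}\hat\rho$ and $\widehat{\mathcal B}(\mathbb C)=\ker\hat\nu/\operatorname{im}\hat\rho$ be the extended pre-Bloch group and the extended Bloch group. Let $\mathbb Z(2)=(2\pi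 i)^2\mathbb Z=4\pi^2\mathbb Z$. **Lemma.** The function $\overline L\colon\overline{\mathbb C}_{\rm cut}\times(2\mathbb Z)^2\to\mathbb C$, $$\overline L(z;2p,2q)=\operatorname{Li}_2(z)+\tfrac12(\operatorname{Log}z+2\pi ip)(\operatorname{Log}(1-z)+2\pi iq)-\tfrac{\pi^2}6,$$ induces a holomorphic function $\widehat L\colon\widehat{\mathbb C}\to\mathbb C/\mathbb Z(2)$, that is, $\widehat L((z;2p,2q))=\overline L(z;2p,2q)\bmod\mathbb Z(2)$. It satisfies the five term relation $\sum_{k=0}^4(-1)^k\widehat L(\hat z_k)=0$ for all $(\hat z_0,\dots,\hat z_4)\in\widehat{FT}$. Hence the additive extension of $\widehat L$ to $\mathbb Z[\widehat{\mathbb C}]$ induces homomorphisms $\widehat{\mathcal P}(\mathbb C)\to\mathbb C/\mathbb Z(2)$ and $\widehat{\mathcal B}(\mathbb C)\to\mathbb C/\mathbb Z(2)$. -/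

import Mathlib

open Complex Filter Topology MeasureTheory
open scoped ComplexConjugate Real

namespace ExtBloch

/-! ### The cut plane with doubled cuts -/

/-- `ℂ_cut = ℂ ∖ ((-∞, 0] ∪ [1, ∞))`. -/
def cutDomain : Set ℂ := {z | ¬ (z.im = 0 ∧ (z.re ≤ 0 ∨ 1 ≤ z.re))}

/-- The cut plane `ℂ_cut` together with two boundary points `x + 0i` (`above`) and
`x - 0i` (`below`) for every real `x` in `(-∞, 0) ∪ (1, ∞)`. -/
inductive CutPlane : Type
  | inner (z : ℂ) (hz : z ∈ cutDomain) : CutPlane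
  | above (x : ℝ) (hx : x < 0 ∨ 1 < x) : CutPlane
  | below (x : ℝ) (hx : x < 0 ∨ 1 < x) : CutPlane

namespace CutPlane

/-- The underlying point of `ℂ ∖ {0, 1}`. -/
def toComplex : CutPlane → ℂ
  | inner z _ => z
  | above x _ => (x : ℂ)
  | below x _ => (x : ℂ)

theorem mem_cutDomain_of_not {z : ℂ} (h0 : z ≠ 0) (h1 : z ≠ 1)
    (h : ¬ (z.im = 0 ∧ (z.re < 0 ∨ 1 < z.re))) : z ∈ cutDomain := by
  rintro ⟨him, hre⟩
  apply h
  refine ⟨him, ?_⟩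
  rcases hre with hre | hre
  · exact Or.inl (lt_of_le_of_ne hre fun e => h0 (Complex.ext e him))
  · exact Or.inr (lt_of_le_of_ne hre fun e => h1 (Complex.ext e.symm him))

open Classical in
/-- The map of the closed upper half plane minus `{0, 1}` to the cut plane: on the cuts it takes the
boundary points `x + 0i`. -/
noncomputable def ofUpper (z : {z : ℂ // 0 ≤ z.im ∧ z ≠ 0 ∧ z ≠ 1}) : CutPlane :=
  if h : z.1.im = 0 ∧ (z.1.re < 0 ∨ 1 < z.1.re) then above z.1.re h.2
  else inner z.1 (mem_cutDomain_of_not z.2.2.1 z.2.2.2 h)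

open Classical in
/-- The map of the closed lower half plane minus `{0, 1}` to the cut plane: on the cuts it takes the
boundary points `x - 0i`. -/
noncomputable def ofLower (z : {z : ℂ // z.im ≤ 0 ∧ z ≠ 0 ∧ z ≠ 1}) : CutPlane :=
  if h : z.1.im = 0 ∧ (z.1.re < 0 ∨ 1 < z.1.re) then below z.1.re h.2
  else inner z.1 (mem_cutDomain_of_not z.2.2.1 z.2.2.2 h)

/-- The topology of the cut plane: it is glued from the two closed half planes (minus `{0, 1}`)
along the interval `(0, 1)`. Hence it is the usual topology on `ℂ_cut`, and `x ± 0i` is the limit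
of `x ± t i` as `t` decreases to `0`. -/
noncomputable instance : TopologicalSpace CutPlane :=
  TopologicalSpace.coinduced ofUpper inferInstance ⊔
    TopologicalSpace.coinduced ofLower inferInstance

/-- The extension of a function on `ℂ_cut` to the boundary points `x ± 0i` by its one-sided limits
`lim f (x ± t i)` as `t` decreases to `0`. It is only applied to functions for which these limits
exist (see `tendsto_log_above` and the lemmas below it). -/
noncomputable def extend (f : ℂ → ℂ) : CutPlane → ℂ
  | inner z _ => f z
  | above x _ => limUnder (𝓝[>] (0 : ℝ)) fun t => f (x + t * I)
  | below x _ => limUnder (𝓝[>] (0 : ℝ)) fun t => f (x - t * I)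

end CutPlane

/-- The principal branch of the dilogarithm on `ℂ ∖ [1, ∞)`:
`Li₂(z) = - ∫_0^z Log(1 - t) dt / t`, along the segment `t = s z`, `0 ≤ s ≤ 1`. -/
noncomputable def dilog (z : ℂ) : ℂ := - ∫ s : ℝ in (0 : ℝ)..1, Complex.log (1 - s * z) / s

namespace CutPlane

/-- `Log z` on the cut plane. -/
noncomputable def log : CutPlane → ℂ := extend Complex.log

/-- `Log (1 - z)` on the cut plane. -/
noncomputable def logOneSub : CutPlane → ℂ := extend fun z => Complex.log (1 - z)

/-- `Li₂ z` on the cut plane. -/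
noncomputable def li2 : CutPlane → ℂ := extend dilog

/-! The one-sided limits in these definitions exist, with the following values. -/

theorem tendsto_log_above (x : ℝ) (hx : x ≠ 0) :
    Tendsto (fun t : ℝ => Complex.log (x + t * I)) (𝓝[>] 0) (𝓝 (Complex.log x)) := by
  have h : Tendsto (fun t : ℝ => (x + t * I : ℂ)) (𝓝[>] 0) (𝓝[{z : ℂ | 0 ≤ z.im}] (x : ℂ)) := by
    refine tendsto_nhdsWithin_iff.2 ⟨?_, ?_⟩
    · have : Continuous fun t : ℝ => (x + t * I : ℂ) := by fun_prop
      simpa using (this.tendsto 0).mono_left nhdsWithin_le_nhds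
    · filter_upwards [self_mem_nhdsWithin] with t ht
      simpa using le_of_lt ht
  rcases lt_or_gt_of_ne hx with hx | hx
  · exact (continuousWithinAt_log_of_re_neg_of_im_zero (z := (x : ℂ)) (by simpa) (by simp)).tendsto.comp h
  · exact ((continuousAt_clog (x := (x : ℂ)) (by simp [slitPlane, hx])).tendsto.comp
      (h.mono_right nhdsWithin_le_nhds))

theorem log_conj_of_im_ne {w : ℂ} (h : w.im ≠ 0) :
    Complex.log (conj w) = conj (Complex.log w) :=
  Complex.log_conj w fun e => h (Complex.arg_eq_pi_iff.1 e).2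

theorem tendsto_log_below (x : ℝ) (hx : x ≠ 0) :
    Tendsto (fun t : ℝ => Complex.log (x - t * I)) (𝓝[>] 0) (𝓝 (conj (Complex.log x))) := by
  refine ((continuous_conj.tendsto _).comp (tendsto_log_above x hx)).congr' ?_
  filter_upwards [self_mem_nhdsWithin] with t ht
  have : (x + t * I : ℂ).im ≠ 0 := by simpa using (ne_of_gt ht : t ≠ 0)
  simp only [Function.comp]
  rw [← log_conj_of_im_ne this]
  simp [sub_eq_add_neg]

theorem tendsto_logOneSub_above (x : ℝ) (hx : x ≠ 1) :
    Tendsto (fun t : ℝ => Complex.log (1 - (x + t * I))) (𝓝[>] 0)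
      (𝓝 (conj (Complex.log (1 - x)))) := by
  have := tendsto_log_below (1 - x) (sub_ne_zero.2 hx.symm)
  simpa [sub_sub] using this

theorem tendsto_logOneSub_below (x : ℝ) (hx : x ≠ 1) :
    Tendsto (fun t : ℝ => Complex.log (1 - (x - t * I))) (𝓝[>] 0)
      (𝓝 (Complex.log (1 - x))) := by
  have := tendsto_log_above (1 - x) (sub_ne_zero.2 hx.symm)
  simpa [sub_add] using this

theorem tendsto_dilog_below (x : ℝ) :
    Tendsto (fun t : ℝ => dilog (x - t * I)) (𝓝[>] 0) (𝓝 (dilog x)) := by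
  refine Tendsto.neg ?_
  set M : ℝ := |x| + 1 with hM
  have hM1 : 1 ≤ M := by have := abs_nonneg x; linarith
  have hM0 : 0 < M := by linarith
  have hne : ∀ᵐ s : ℝ, 1 - s * x ≠ 0 := by
    have : ∀ᵐ s : ℝ, s ≠ x⁻¹ := by simp [ae_iff]
    filter_upwards [this] with s hs h
    exact hs (eq_inv_of_mul_eq_one_left (by linarith))
  refine intervalIntegral.tendsto_integral_filter_of_dominated_convergence
    (fun s => 3 / 2 * M + 2 * M * (|Real.log ‖1 - s * x‖| + Real.log (1 + M) + π)) ?_ ?_ ?_ ?_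
  · refine Eventually.of_forall fun t => Measurable.aestronglyMeasurable ?_
    exact (Complex.measurable_log.comp (by fun_prop)).div (by fun_prop)
  · have ht1 : ∀ᶠ t : ℝ in 𝓝[>] 0, t < 1 := nhdsWithin_le_nhds (Iio_mem_nhds one_pos)
    filter_upwards [self_mem_nhdsWithin, ht1] with t ht0 ht1
    have ht0 : 0 < t := ht0
    filter_upwards [hne] with s hs hsI
    rw [Set.uIoc_of_le zero_le_one] at hsI
    obtain ⟨hs0, hs1⟩ := hsI
    have hz : ‖(x - t * I : ℂ)‖ ≤ M := by
      calc ‖(x - t * I : ℂ)‖ ≤ ‖(x : ℂ)‖ + ‖(t * I : ℂ)‖ := norm_sub_le _ _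
        _ = |x| + t := by simp [abs_of_pos ht0]
        _ ≤ M := by linarith
    have hlogM : 0 ≤ Real.log (1 + M) := Real.log_nonneg (by linarith)
    have hpi := Real.pi_pos
    have habs := abs_nonneg (Real.log ‖1 - s * x‖)
    rw [norm_div, Complex.norm_real, Real.norm_of_nonneg hs0.le, div_le_iff₀ hs0]
    have hsz : ‖(s * (x - t * I) : ℂ)‖ ≤ s * M := by
      rw [norm_mul, Complex.norm_real, Real.norm_of_nonneg hs0.le]
      gcongr
    by_cases hsm : s * M ≤ 1 / 2
    · have := Complex.norm_log_one_add_half_le_self (z := -(s * (x - t * I) : ℂ))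
        (by rw [norm_neg]; linarith)
      rw [norm_neg, ← sub_eq_add_neg] at this
      have h2 : 0 ≤ 2 * M * (|Real.log ‖1 - s * x‖| + Real.log (1 + M) + π) := by positivity
      nlinarith [mul_nonneg h2 hs0.le]
    · push Not at hsm
      set w : ℂ := 1 - s * (x - t * I) with hw
      have hw1 : ‖w‖ ≤ 1 + M := by
        calc ‖w‖ ≤ ‖(1 : ℂ)‖ + ‖(s * (x - t * I) : ℂ)‖ := norm_sub_le _ _
          _ ≤ 1 + s * M := by simpa using hsz
          _ ≤ 1 + M := by nlinarith
      have hw2 : ‖1 - s * x‖ ≤ ‖w‖ := by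
        have : w.re = 1 - s * x := by simp [hw]
        rw [← this]
        exact Complex.abs_re_le_norm w
      have hpos : 0 < ‖1 - s * x‖ := norm_pos_iff.2 hs
      have hlw : |Real.log ‖w‖| ≤ |Real.log ‖1 - s * x‖| + Real.log (1 + M) := by
        have h1 := Real.log_le_log hpos hw2
        have h2 := Real.log_le_log (hpos.trans_le hw2) hw1
        have h3 := neg_abs_le (Real.log ‖1 - s * x‖)
        exact abs_le.2 ⟨by linarith, by linarith⟩
      have hl : ‖Complex.log w‖ ≤ |Real.log ‖w‖| + π := by
        calc ‖Complex.log w‖ ≤ |(Complex.log w).re| + |(Complex.log w).im| :=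
              Complex.norm_le_abs_re_add_abs_im _
          _ ≤ |Real.log ‖w‖| + π := by
              rw [Complex.log_re, Complex.log_im]
              gcongr
              exact Complex.abs_arg_le_pi w
      have hB : 0 ≤ |Real.log ‖1 - s * x‖| + Real.log (1 + M) + π := by positivity
      nlinarith [mul_nonneg hB (sub_nonneg.2 hsm.le), mul_pos hM0 hs0]
  · have hlog : IntervalIntegrable (fun s : ℝ => Real.log ‖1 - s * x‖) volume 0 1 :=
      MeromorphicOn.intervalIntegrable_log_norm (f := fun s : ℝ => 1 - s * x)
        (fun s _ => AnalyticAt.meromorphicAt (by fun_prop))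
    exact intervalIntegrable_const.add
      (((hlog.abs.add intervalIntegrable_const).add intervalIntegrable_const).const_mul _)
  · filter_upwards [hne] with s hs hsI
    rw [Set.uIoc_of_le zero_le_one] at hsI
    obtain ⟨hs0, hs1⟩ := hsI
    refine Tendsto.div_const ?_ _
    have h := tendsto_log_above (1 - s * x) hs
    have hmul : Tendsto (fun t : ℝ => s * t) (𝓝[>] 0) (𝓝[>] 0) := by
      refine tendsto_nhdsWithin_iff.2 ⟨?_, ?_⟩
      · have : Continuous fun t : ℝ => s * t := by fun_prop
        simpa using (this.tendsto 0).mono_left nhdsWithin_le_nhds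
      · filter_upwards [self_mem_nhdsWithin] with t ht
        exact mul_pos hs0 ht
    have h2 := h.comp hmul
    push_cast at h2
    refine h2.congr fun t => ?_
    simp only [Function.comp]
    congr 1
    push_cast
    ring

theorem dilog_conj_of_im_ne {z : ℂ} (h : z.im ≠ 0) : dilog (conj z) = conj (dilog z) := by
  unfold dilog
  rw [map_neg, ← intervalIntegral.intervalIntegral_conj]
  congr 1
  refine intervalIntegral.integral_congr_ae (Eventually.of_forall fun s hs => ?_)
  rw [Set.uIoc_of_le zero_le_one] at hs
  have hs0 : s ≠ 0 := hs.1.ne'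
  rw [map_div₀, ← log_conj_of_im_ne (w := 1 - s * z) (by simp [hs0, h])]
  simp

theorem tendsto_dilog_above (x : ℝ) :
    Tendsto (fun t : ℝ => dilog (x + t * I)) (𝓝[>] 0) (𝓝 (conj (dilog x))) := by
  refine ((continuous_conj.tendsto _).comp (tendsto_dilog_below x)).congr' ?_
  filter_upwards [self_mem_nhdsWithin] with t ht
  have : (x - t * I : ℂ).im ≠ 0 := by simpa using (ne_of_gt ht : t ≠ 0)
  simp only [Function.comp]
  rw [← dilog_conj_of_im_ne this]
  simp

theorem ne_zero_of_cut {x : ℝ} (hx : x < 0 ∨ 1 < x) : x ≠ 0 := by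
  rcases hx with h | h <;> linarith

theorem ne_one_of_cut {x : ℝ} (hx : x < 0 ∨ 1 < x) : x ≠ 1 := by
  rcases hx with h | h <;> linarith

theorem log_above (x : ℝ) (hx : x < 0 ∨ 1 < x) : log (above x hx) = Complex.log x :=
  (tendsto_log_above x (ne_zero_of_cut hx)).limUnder_eq

theorem log_below (x : ℝ) (hx : x < 0 ∨ 1 < x) : log (below x hx) = conj (Complex.log x) :=
  (tendsto_log_below x (ne_zero_of_cut hx)).limUnder_eq

theorem logOneSub_above (x : ℝ) (hx : x < 0 ∨ 1 < x) :
    logOneSub (above x hx) = conj (Complex.log (1 - x)) :=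
  (tendsto_logOneSub_above x (ne_one_of_cut hx)).limUnder_eq

theorem logOneSub_below (x : ℝ) (hx : x < 0 ∨ 1 < x) :
    logOneSub (below x hx) = Complex.log (1 - x) :=
  (tendsto_logOneSub_below x (ne_one_of_cut hx)).limUnder_eq

theorem li2_above (x : ℝ) (hx : x < 0 ∨ 1 < x) : li2 (above x hx) = conj (dilog x) :=
  (tendsto_dilog_above x).limUnder_eq

theorem li2_below (x : ℝ) (hx : x < 0 ∨ 1 < x) : li2 (below x hx) = dilog x :=
  (tendsto_dilog_below x).limUnder_eq

end CutPlane

/-! ### The universal abelian cover of `ℂ ∖ {0, 1}` -/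

/-- The gluing of the sheets of `CutPlane × (2ℤ)²`. The triple `(a, p, q)` stands for
`(a, 2p, 2q)`. -/
inductive Glue : CutPlane × ℤ × ℤ → CutPlane × ℤ × ℤ → Prop
  | neg (x : ℝ) (hx : x < 0) (p q : ℤ) :
      Glue (.above x (.inl hx), p, q) (.below x (.inl hx), p + 1, q)
  | one (x : ℝ) (hx : 1 < x) (p q : ℤ) :
      Glue (.above x (.inr hx), p, q) (.below x (.inr hx), p, q + 1)

/-- The universal abelian cover `Ĉ` of `ℂ ∖ {0, 1}`: the quotient of `CutPlane × (2ℤ)²` by the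
equivalence relation generated by `Glue`. -/
def Cover : Type := Quot Glue

/-- The quotient topology (`(2ℤ)²` is discrete). -/
instance : TopologicalSpace Cover := inferInstanceAs (TopologicalSpace (Quot Glue))

namespace Cover

/-- The class `(a; 2p, 2q)`. -/
def mk (a : CutPlane) (p q : ℤ) : Cover := Quot.mk Glue (a, p, q)

/-- The covering projection `π̂` to `ℂ ∖ {0, 1} ⊆ ℂ`. -/
def proj : Cover → ℂ :=
  Quot.lift (fun a => a.1.toComplex) (by rintro _ _ (_ | _) <;> rfl)

theorem log_glue_neg (x : ℝ) (hx : x < 0) :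
    Complex.log x = conj (Complex.log x) + 2 * π * I := by
  have h : Complex.arg x = π := Complex.arg_ofReal_of_neg hx
  apply Complex.ext
  · simp
  · simp [Complex.log_im, h]; ring

/-- The function `(z; 2p, 2q) ↦ Log z + 2πi p` on the cover. -/
noncomputable def w0 : Cover → ℂ :=
  Quot.lift (fun a => a.1.log + 2 * π * I * a.2.1) (by
    rintro _ _ (⟨x, hx, p, q⟩ | ⟨x, hx, p, q⟩)
    · simp only [CutPlane.log_above, CutPlane.log_below]
      have h := log_glue_neg x hx
      push_cast
      linear_combination h
    · simp only [CutPlane.log_above, CutPlane.log_below]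
      rw [← Complex.ofReal_log (by linarith), Complex.conj_ofReal])

/-- The function `(z; 2p, 2q) ↦ -Log (1 - z) + 2πi q` on the cover. -/
noncomputable def w1 : Cover → ℂ :=
  Quot.lift (fun a => -a.1.logOneSub + 2 * π * I * a.2.2) (by
    rintro _ _ (⟨x, hx, p, q⟩ | ⟨x, hx, p, q⟩)
    · simp only [CutPlane.logOneSub_above, CutPlane.logOneSub_below]
      have : (1 - x : ℂ) = ((1 - x : ℝ) : ℂ) := by push_cast; rfl
      rw [this, ← Complex.ofReal_log (by linarith), Complex.conj_ofReal]
    · simp only [CutPlane.logOneSub_above, CutPlane.logOneSub_below]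
      have : (1 - x : ℂ) = ((1 - x : ℝ) : ℂ) := by push_cast; rfl
      have h := log_glue_neg (1 - x) (by linarith)
      rw [this]
      push_cast at h ⊢
      linear_combination h)

/-- A function on the cover with values in a quotient `ℂ ⧸ Λ` of the complex plane (by a discrete
subgroup) is holomorphic if near every point it is the class of a holomorphic function of the local
coordinate `π̂`. -/
def IsHolomorphic {Λ : AddSubgroup ℂ} (f : Cover → ℂ ⧸ Λ) : Prop :=
  ∀ x : Cover, ∃ g : ℂ → ℂ, AnalyticAt ℂ g (proj x) ∧
    ∀ᶠ y in 𝓝 x, f y = (QuotientAddGroup.mk (g (proj y)) : ℂ ⧸ Λ)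

end Cover

/-! ### The five term relations and the extended Bloch group -/

/-- The set `FT` of five term relations. -/
def FT : Set (Fin 5 → ℂ) :=
  {z | ∃ x y : ℂ, x ≠ y ∧ x ≠ 0 ∧ x ≠ 1 ∧ y ≠ 0 ∧ y ≠ 1 ∧
    z = ![x, y, y / x, (1 - 1 / x) / (1 - 1 / y), (1 - x) / (1 - y)]}

/-- `FT⁺`: the elements of `FT` all of whose entries have positive imaginary part. -/
def FTplus : Set (Fin 5 → ℂ) := {z | z ∈ FT ∧ ∀ k, 0 < (z k).im}

/-- The lift of `FT⁺` to the sheet `p = q = 0`. -/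
def FThatPlus : Set (Fin 5 → Cover) :=
  {w | ∃ z ∈ FTplus, ∃ h : ∀ k, z k ∈ cutDomain, w = fun k => Cover.mk (.inner (z k) (h k)) 0 0}

/-- The preimage `π̂⁻¹(FT)` in `Ĉ⁵`. -/
def preFT : Set (Fin 5 → Cover) := {w | (fun k => (w k).proj) ∈ FT}

/-- The connected component of `π̂⁻¹(FT)` that contains the (connected) set `FThatPlus`. -/
def FThat : Set (Fin 5 → Cover) := {w | ∃ a ∈ FThatPlus, w ∈ connectedComponentIn preFT a}

/-- `ρ̂ : ℤ[F̂T] → ℤ[Ĉ]`. -/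
noncomputable def rhoHat : FreeAbelianGroup FThat →+ FreeAbelianGroup Cover :=
  FreeAbelianGroup.lift fun z =>
    .of (z.1 0) - .of (z.1 1) + .of (z.1 2) - .of (z.1 3) + .of (z.1 4)

/-- `ν̂ : ℤ[Ĉ] → ℂ ∧_ℤ ℂ`. -/
noncomputable def nuHat : FreeAbelianGroup Cover →+ ⋀[ℤ]^2 ℂ :=
  FreeAbelianGroup.lift fun z => exteriorPower.ιMulti ℤ 2 ![z.w0, z.w1]

/-- The extended pre-Bloch group `ℤ[Ĉ] / im ρ̂`. -/
abbrev PreBlochHat : Type := FreeAbelianGroup Cover ⧸ rhoHat.range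

/-- The extended Bloch group `ker ν̂ / im ρ̂`. -/
abbrev BlochHat : Type := nuHat.ker ⧸ rhoHat.range.addSubgroupOf nuHat.ker

/-! ### The extended Rogers dilogarithm -/

/-- `ℤ(2) = (2πi)² ℤ = 4π² ℤ`. -/
noncomputable def Z2 : AddSubgroup ℂ := AddSubgroup.zmultiples ((2 * π * I) ^ 2)

/-- The function
`L̄(z; 2p, 2q) = Li₂ z + (Log z + 2πi p) (Log (1 - z) + 2πi q) / 2 - π² / 6`. -/
noncomputable def Lbar (a : CutPlane) (p q : ℤ) : ℂ :=
  a.li2 + 1 / 2 * (a.log + 2 * π * I * p) * (a.logOneSub + 2 * π * I * q) - π ^ 2 / 6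

end ExtBloch

open ExtBloch

/-! On the cover, `w0` and `w1` are continuous single-valued logarithms of `z` and of `1 / (1 - z)`.
In these coordinates `Lbar` is `li2 + 2πi q w0 - w0 w1 / 2 - π² / 6`, so its branches are primitives
of `(w1 dw0 - w0 dw1) / 2`. Only `li2` and the term `2πi q w0` depend on the representative. Nothing
changes across the negative axis. Across `(1, ∞)` the jump `2πi log x` of the dilogarithm is
compensated by the shift of `q` up to `(2πi)² p`. Hence the value modulo `ℤ(2)` is well defined
(`Lbar_glue`), and it is holomorphic (`Cover.exists_isRogersAt`).

For the five term relation, the entries of `FT` satisfy multiplicative identities. Their logarithmic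
versions `FiveRel` can fail only by elements of `2πiℤ`, so `FiveRel` is an open and closed condition
on `preFT`. It holds on `FThatPlus`, where all imaginary parts lie in `(0, π)` (`fiveRel_log`).
Where `FiveRel` holds, the alternating sum of the forms `w1 dw0 - w0 dw1` vanishes identically, so
the alternating sum of `Lhat` is locally constant (`hasFDerivAt_alternating_sum`,
`eventually_isFiveTerm_iff`).

The constant is computed on `FT⁺` by moving `x` to `y` along a segment (`rogers_five_term`). The
entries tend to `y, y, 1, 1, 1`, and the Rogers dilogarithm tends to `0` at `1`; the summand `-π² /
6` serves this purpose. The homomorphisms follow because `Lhat` kills the image of `rhoHat`. -/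

namespace ExtBloch

/-! ### The dilogarithm integral: derivative and value at `1`. -/

theorem one_sub_mul_mem_slitPlane {z : ℂ} (hz : 1 - z ∈ slitPlane) {s : ℝ} (hs : 0 ≤ s)
    (hs1 : s ≤ 1) : 1 - s * z ∈ slitPlane := by
  have h := starConvex_one_slitPlane hz (sub_nonneg.2 hs1) hs (by ring)
  simp only [real_smul] at h
  convert h using 1
  push_cast
  ring

theorem isOpen_one_sub_mem_slitPlane : IsOpen {z : ℂ | 1 - z ∈ slitPlane} :=
  isOpen_slitPlane.preimage (by fun_prop : Continuous fun z : ℂ => 1 - z)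

theorem hasDerivAt_log_one_sub {z : ℂ} (hz : 1 - z ∈ slitPlane) :
    HasDerivAt (fun z : ℂ => Complex.log (1 - z)) (-(1 / (1 - z))) z := by
  have h := ((hasDerivAt_id z).const_sub 1).clog hz
  simpa [neg_div] using h

/-- The integrand is the difference quotient at `0` of `s ↦ Log (1 - s z)`, so the singularity at `s
= 0` is removable. -/
theorem intervalIntegrable_dilog_integrand {z : ℂ} (hz : 1 - z ∈ slitPlane) :
    IntervalIntegrable (fun s : ℝ => Complex.log (1 - s * z) / s) volume 0 1 := by
  set f : ℝ → ℂ := fun s => Complex.log (1 - s * z) with hf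
  set U : Set ℝ := {s | (1 - s * z : ℂ) ∈ slitPlane} with hU
  have hUo : IsOpen U :=
    isOpen_slitPlane.preimage (by fun_prop : Continuous fun s : ℝ => (1 - s * z : ℂ))
  have hd : DifferentiableOn ℝ f U := by
    intro s hs
    have h1 : HasDerivAt (fun s : ℝ => (1 - s * z : ℂ)) (-(1 * z)) s :=
      ((ofRealCLM.hasDerivAt (x := s)).mul_const z).const_sub 1
    exact (h1.clog_real hs).differentiableAt.differentiableWithinAt
  have hU0 : U ∈ 𝓝 (0 : ℝ) := hUo.mem_nhds (by simp [hU])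
  have hc : ContinuousOn (dslope f 0) U :=
    (continuousOn_dslope hU0).2 ⟨hd.continuousOn, hd.differentiableAt hU0⟩
  have hc' : ContinuousOn (dslope f 0) (Set.uIcc 0 1) := hc.mono fun s hs => by
    rw [Set.uIcc_of_le zero_le_one] at hs
    exact one_sub_mul_mem_slitPlane hz hs.1 hs.2
  refine hc'.intervalIntegrable.congr fun s hs => ?_
  rw [Set.uIoc_of_le zero_le_one] at hs
  rw [dslope_of_ne _ hs.1.ne', slope]
  simp [hf, div_eq_inv_mul]

/-- Differentiation under the integral sign cancels the factor `1 / s`, and compactness bounds the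
result. Unlike the closed form `-Log (1 - z) / z`, this expression remains valid at `z = 0`. -/
theorem hasDerivAt_dilog_integral {z : ℂ} (hz : 1 - z ∈ slitPlane) :
    HasDerivAt dilog (∫ s : ℝ in (0 : ℝ)..1, 1 / (1 - s * z)) z := by
  obtain ⟨r, hr, hrs⟩ := Metric.nhds_basis_closedBall.mem_iff.1
    (isOpen_one_sub_mem_slitPlane.mem_nhds hz)
  have hne : ∀ s ∈ Set.Icc (0 : ℝ) 1, ∀ w ∈ Metric.closedBall z r,
      (1 - s * w : ℂ) ∈ slitPlane :=
    fun s hs w hw => one_sub_mul_mem_slitPlane (hrs hw) hs.1 hs.2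
  have hcont : ContinuousOn (fun p : ℝ × ℂ => -1 / (1 - p.1 * p.2))
      (Set.Icc (0 : ℝ) 1 ×ˢ Metric.closedBall z r) := by
    refine continuousOn_const.div (by fun_prop) fun p hp => ?_
    exact slitPlane_ne_zero (hne p.1 hp.1 p.2 hp.2)
  obtain ⟨C, hC⟩ := (isCompact_Icc.prod (isCompact_closedBall z r)).exists_bound_of_continuousOn
    hcont
  have key := (intervalIntegral.hasDerivAt_integral_of_dominated_loc_of_deriv_le
    (μ := volume) (a := 0) (b := 1) (x₀ := z) (s := Metric.closedBall z r) (𝕜 := ℂ)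
    (F := fun w s => Complex.log (1 - s * w) / s) (F' := fun w s => -1 / (1 - s * w))
    (bound := fun _ => C) (Metric.closedBall_mem_nhds z hr) ?_ ?_ ?_ ?_ ?_ ?_).2
  · refine (show HasDerivAt dilog _ z from key.neg).congr_deriv ?_
    rw [← intervalIntegral.integral_neg]
    congr 1
    ext s
    ring
  · refine Eventually.of_forall fun w => Measurable.aestronglyMeasurable ?_
    exact (Complex.measurable_log.comp (by fun_prop)).div (by fun_prop)
  · exact intervalIntegrable_dilog_integrand hz
  · exact Measurable.aestronglyMeasurable (by fun_prop)
  · refine Eventually.of_forall fun s hs w hw => ?_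
    rw [Set.uIoc_of_le zero_le_one] at hs
    exact hC (s, w) ⟨⟨hs.1.le, hs.2⟩, hw⟩
  · exact intervalIntegrable_const
  · refine Eventually.of_forall fun s hs w hw => ?_
    rw [Set.uIoc_of_le zero_le_one] at hs
    have hs0 : (s : ℂ) ≠ 0 := by exact_mod_cast hs.1.ne'
    have h1 := ((((hasDerivAt_id w).const_mul (s : ℂ)).const_sub 1).clog
      (hne s ⟨hs.1.le, hs.2⟩ w hw)).div_const (s : ℂ)
    have hw0 := slitPlane_ne_zero (hne s ⟨hs.1.le, hs.2⟩ w hw)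
    refine h1.congr_deriv ?_
    rw [mul_one, neg_div, neg_div, div_right_comm, div_self hs0, neg_div, id]

theorem hasDerivAt_dilog {z : ℂ} (hz : 1 - z ∈ slitPlane) (h0 : z ≠ 0) :
    HasDerivAt dilog (-Complex.log (1 - z) / z) z := by
  convert hasDerivAt_dilog_integral hz using 1
  have hmem : ∀ s ∈ Set.uIcc (0 : ℝ) 1, (1 - s * z : ℂ) ∈ slitPlane := fun s hs => by
    rw [Set.uIcc_of_le zero_le_one] at hs
    exact one_sub_mul_mem_slitPlane hz hs.1 hs.2
  have h := intervalIntegral.integral_eq_sub_of_hasDerivAt (a := 0) (b := 1)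
    (f := fun s : ℝ => -Complex.log (1 - s * z) / z) (f' := fun s : ℝ => 1 / (1 - s * z)) ?_ ?_
  · rw [h]
    simp
  · intro s hs
    have h1 : HasDerivAt (fun s : ℝ => (1 - s * z : ℂ)) (-(1 * z)) s :=
      ((ofRealCLM.hasDerivAt (x := s)).mul_const z).const_sub 1
    have h2 := ((h1.clog_real (hmem s hs)).neg).div_const z
    have := slitPlane_ne_zero (hmem s hs)
    refine h2.congr_deriv ?_
    field_simp
  · refine ContinuousOn.intervalIntegrable ?_
    exact continuousOn_const.div (by fun_prop) fun s hs => slitPlane_ne_zero (hmem s hs)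

theorem dilog_zero : dilog 0 = 0 := by simp [dilog]

theorem continuousAt_dilog_zero : ContinuousAt dilog 0 :=
  (hasDerivAt_dilog_integral (by simp)).continuousAt

/-- Termwise integration of `-log (1 - s) / s = ∑ sⁿ / (n + 1)` reduces the value to the Basel sum.
-/
theorem dilog_one : dilog 1 = π ^ 2 / 6 := by
  have hz : HasSum (fun n : ℕ => (1 : ℝ) / ((n : ℝ) + 1) ^ 2) (π ^ 2 / 6) := by
    have h := (hasSum_nat_add_iff' 1).2 hasSum_zeta_two
    simpa using h
  have hint : ∀ n : ℕ, ∫ s : ℝ in (0 : ℝ)..1, s ^ n / ((n : ℝ) + 1) = 1 / ((n : ℝ) + 1) ^ 2 := by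
    intro n
    rw [intervalIntegral.integral_div, integral_pow]
    rw [one_pow, zero_pow n.succ_ne_zero]
    field_simp
    ring
  have hS := hasSum_integral_of_summable_integral_norm
    (μ := volume.restrict (Set.Ioc (0 : ℝ) 1))
    (F := fun (n : ℕ) (s : ℝ) => s ^ n / ((n : ℝ) + 1)) ?_ ?_
  · have hI : ∀ n : ℕ, ∫ s : ℝ in Set.Ioc 0 1, s ^ n / ((n : ℝ) + 1) = 1 / ((n : ℝ) + 1) ^ 2 := by
      intro n
      rw [← hint n, intervalIntegral.integral_of_le zero_le_one]
    simp only [hI] at hS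
    have hval := hz.unique hS
    have hae : ∫ s : ℝ in Set.Ioc 0 1, ∑' n : ℕ, s ^ n / ((n : ℝ) + 1)
        = ∫ s : ℝ in Set.Ioc 0 1, -Real.log (1 - s) / s := by
      have h1 : ∀ᵐ s : ℝ, s ≠ 1 := by simp [ae_iff]
      refine setIntegral_congr_ae measurableSet_Ioc ?_
      filter_upwards [h1] with s hs1 hs
      have hlt : |s| < 1 := abs_lt.2 ⟨by linarith [hs.1], lt_of_le_of_ne hs.2 hs1⟩
      have h2 := (Real.hasSum_pow_div_log_of_abs_lt_one hlt).div_const s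
      refine (h2.congr_fun fun n => ?_).tsum_eq
      have := hs.1.ne'
      field_simp
      ring
    rw [hae, ← intervalIntegral.integral_of_le zero_le_one] at hval
    have : dilog 1 = ((∫ s : ℝ in (0 : ℝ)..1, -Real.log (1 - s) / s : ℝ) : ℂ) := by
      rw [dilog, ← intervalIntegral.integral_neg, ← intervalIntegral.integral_ofReal]
      refine intervalIntegral.integral_congr fun s hs => ?_
      rw [Set.uIcc_of_le zero_le_one] at hs
      rw [ofReal_div, ofReal_neg, ofReal_log (by linarith [hs.2])]
      push_cast
      rw [mul_one, neg_div]
    rw [this, ← hval]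
    push_cast
    rfl
  · intro n
    have : Continuous fun s : ℝ => s ^ n / ((n : ℝ) + 1) := by fun_prop
    exact (intervalIntegrable_iff_integrableOn_Ioc_of_le zero_le_one).1
      (this.intervalIntegrable 0 1)
  · refine hz.summable.congr fun n => ?_
    rw [← hint n, intervalIntegral.integral_of_le zero_le_one]
    refine setIntegral_congr_fun measurableSet_Ioc fun s hs => ?_
    have := hs.1.le
    rw [Real.norm_of_nonneg (by positivity)]

/-! ### The cut plane and the reflection formula. -/

theorem mem_cutDomain_iff {z : ℂ} : z ∈ cutDomain ↔ z ∈ slitPlane ∧ 1 - z ∈ slitPlane := by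
  simp only [cutDomain, slitPlane, Set.mem_ofPred_eq, sub_re, one_re, sub_im, one_im, zero_sub,
    ne_eq, neg_eq_zero, sub_pos, not_and, not_or, not_le]
  tauto

theorem isOpen_cutDomain : IsOpen cutDomain := by
  have : cutDomain = slitPlane ∩ {z | 1 - z ∈ slitPlane} := by
    ext z
    exact mem_cutDomain_iff
  rw [this]
  exact isOpen_slitPlane.inter isOpen_one_sub_mem_slitPlane

open scoped ComplexOrder in
theorem isPreconnected_cutDomain : IsPreconnected cutDomain := by
  -- A slit plane is star-shaped about every positive real, and `1 / 2` is fixed by `z ↦ 1 - z`, so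
  -- it is a centre for both slits at once.
  have h : StarConvex ℝ (1 / 2 : ℂ) cutDomain := by
    intro z hz a b ha hb hab
    rw [mem_cutDomain_iff] at hz ⊢
    have h2 : (0 : ℂ) < ((1 / 2 : ℝ) : ℂ) := Complex.zero_lt_real.2 (by norm_num)
    have e2 : ((1 / 2 : ℝ) : ℂ) = 1 / 2 := by push_cast; rfl
    refine ⟨e2 ▸ starConvex_slitPlane h2 hz.1 ha hb hab, ?_⟩
    have h := starConvex_slitPlane h2 hz.2 ha hb hab
    rw [e2] at h
    convert h using 1
    have : (a : ℂ) + b = 1 := by exact_mod_cast hab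
    simp only [real_smul]
    linear_combination (-1 : ℂ) * this
  exact (h.isPathConnected (mem_cutDomain_iff.2
    ⟨by norm_num [slitPlane], by norm_num [slitPlane]⟩)).isConnected.isPreconnected

theorem cutDomain_of_im_ne_zero {z : ℂ} (h : z.im ≠ 0) : z ∈ cutDomain := fun h' => h h'.1

/-- Near `0` one has `|Log (1 - w)| ≤ 2|w|` and `|Log w| ≤ |log |w|| + π`, and `r log r → 0`. The
convention `Log 0 = 0` allows the full neighbourhood of `0`. -/
theorem tendsto_log_mul_log_one_sub :
    Tendsto (fun w : ℂ => Complex.log w * Complex.log (1 - w)) (𝓝 0) (𝓝 0) := by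
  have hb : Tendsto (fun w : ℂ => 2 * (|Real.log ‖w‖ * ‖w‖| + π * ‖w‖)) (𝓝 0) (𝓝 0) := by
    have h1 : Tendsto (fun w : ℂ => Real.log ‖w‖ * ‖w‖) (𝓝 0) (𝓝 0) := by
      have := Real.continuous_mul_log.comp (continuous_norm (E := ℂ))
      have h := this.tendsto 0
      simpa [Function.comp_def, mul_comm] using h
    have h2 : Tendsto (fun w : ℂ => π * ‖w‖) (𝓝 0) (𝓝 0) := by
      have : Continuous fun w : ℂ => π * ‖w‖ := by fun_prop
      simpa using this.tendsto 0
    simpa using (h1.abs.add h2).const_mul 2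
  refine squeeze_zero_norm' ?_ hb
  filter_upwards [Metric.ball_mem_nhds (0 : ℂ) (half_pos one_pos)] with w hw
  have hw' : ‖-w‖ ≤ 1 / 2 := by
    rw [norm_neg]
    exact (mem_ball_zero_iff.1 hw).le
  have h1 := Complex.norm_log_one_add_half_le_self hw'
  rw [norm_neg, ← sub_eq_add_neg] at h1
  have h2 : ‖Complex.log w‖ ≤ |Real.log ‖w‖| + π := by
    calc ‖Complex.log w‖ ≤ |(Complex.log w).re| + |(Complex.log w).im| :=
          Complex.norm_le_abs_re_add_abs_im _
      _ ≤ |Real.log ‖w‖| + π := by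
          rw [Complex.log_re, Complex.log_im]
          gcongr
          exact Complex.abs_arg_le_pi w
  have hpi := Real.pi_pos
  rw [norm_mul, abs_mul, abs_of_nonneg (norm_nonneg w)]
  calc ‖Complex.log w‖ * ‖Complex.log (1 - w)‖
      ≤ (|Real.log ‖w‖| + π) * (2 * ‖w‖) := by
        gcongr
        linarith [norm_nonneg w]
    _ = _ := by ring

theorem tendsto_log_mul_log_one_sub_one :
    Tendsto (fun z : ℂ => Complex.log z * Complex.log (1 - z)) (𝓝 1) (𝓝 0) := by
  have h : Tendsto (fun z : ℂ => 1 - z) (𝓝 1) (𝓝 0) := by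
    have : Continuous fun z : ℂ => 1 - z := by fun_prop
    simpa using this.tendsto 1
  refine (tendsto_log_mul_log_one_sub.comp h).congr fun z => ?_
  simp [mul_comm]

/-- Euler's reflection formula for the dilogarithm. -/
theorem dilog_add_dilog_one_sub {z : ℂ} (hz : z ∈ cutDomain) :
    dilog z + dilog (1 - z) + Complex.log z * Complex.log (1 - z) = π ^ 2 / 6 := by
  set f : ℂ → ℂ := fun z => dilog z + dilog (1 - z) + Complex.log z * Complex.log (1 - z) with hf
  have hd : ∀ z ∈ cutDomain, HasDerivAt f 0 z := by
    intro z hz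
    obtain ⟨h1, h2⟩ := mem_cutDomain_iff.1 hz
    have hz0 := slitPlane_ne_zero h1
    have hz1 := slitPlane_ne_zero h2
    have d1 := hasDerivAt_dilog h2 hz0
    have d2 : HasDerivAt (fun z => dilog (1 - z)) _ z :=
      (hasDerivAt_dilog (z := 1 - z) (by simpa using h1) hz1).comp z
        ((hasDerivAt_id z).const_sub 1)
    have d3 := (Complex.hasDerivAt_log h1).mul (hasDerivAt_log_one_sub h2)
    refine ((d1.add d2).add d3).congr_deriv ?_
    rw [sub_sub_cancel]
    field_simp
    ring
  have hconst := fun w (hw : w ∈ cutDomain) => isOpen_cutDomain.is_const_of_deriv_eq_zero isPreconnected_cutDomain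
    (fun w hw => (hd w hw).differentiableAt.differentiableWithinAt)
    (fun w hw => (hd w hw).deriv) hz hw
  -- The constant is evaluated at the boundary point `1`, approached from below, where the one-sided
  -- limit of `dilog` is its value at `1`.
  have hlim : Tendsto (fun t : ℝ => f (1 - t * I)) (𝓝[>] 0) (𝓝 (π ^ 2 / 6)) := by
    have hc : Continuous fun t : ℝ => (1 - t * I : ℂ) := by fun_prop
    have hc1 : Tendsto (fun t : ℝ => (1 - t * I : ℂ)) (𝓝[>] 0) (𝓝 1) := by
      simpa using (hc.tendsto 0).mono_left nhdsWithin_le_nhds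
    have hc2 : Tendsto (fun t : ℝ => (1 - (1 - t * I) : ℂ)) (𝓝[>] 0) (𝓝 0) := by
      simpa using hc1.const_sub 1
    have l1 := CutPlane.tendsto_dilog_below 1
    rw [ofReal_one, dilog_one] at l1
    have l2 := continuousAt_dilog_zero.tendsto.comp hc2
    have l3 := tendsto_log_mul_log_one_sub_one.comp hc1
    rw [dilog_zero] at l2
    simpa [hf] using (l1.add l2).add l3
  refine tendsto_nhds_unique (Tendsto.congr' ?_ tendsto_const_nhds) hlim
  filter_upwards [self_mem_nhdsWithin] with t ht
  refine hconst _ (cutDomain_of_im_ne_zero ?_)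
  simpa using (ne_of_gt ht : t ≠ 0)

/-! ### Continuation of the dilogarithm across `(1, ∞)`. -/

/-- The analytic continuation of the dilogarithm from the upper half plane across `(1, ∞)`. -/
noncomputable def dilogUp (z : ℂ) : ℂ :=
  π ^ 2 / 6 - Complex.log z * (Complex.log (z - 1) - π * I) - dilog (1 - z)

/-- The branch `Log (z - 1) - πi` continues `Log (1 - z)` from the upper half plane, and `dilogUp`
is the reflection formula with this branch inserted. -/
theorem hasDerivAt_dilogUp {z : ℂ} (hz : 1 < z.re) :
    HasDerivAt dilogUp (-(Complex.log (z - 1) - π * I) / z) z := by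
  have h1 : z ∈ slitPlane := Or.inl (by linarith)
  have h2 : z - 1 ∈ slitPlane := Or.inl (by simpa using hz)
  have hz0 := slitPlane_ne_zero h1
  have hz1 := slitPlane_ne_zero h2
  have hz1' : 1 - z ≠ 0 := by
    rw [← neg_sub]
    exact neg_ne_zero.2 hz1
  have d2 : HasDerivAt (fun z => dilog (1 - z)) _ z :=
    (hasDerivAt_dilog (z := 1 - z) (by simpa using h1) hz1').comp z
      ((hasDerivAt_id z).const_sub 1)
  have d3 := (Complex.hasDerivAt_log h1).mul
    ((((hasDerivAt_id z).sub_const 1).clog h2).sub_const (π * I))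
  refine (((hasDerivAt_const z (π ^ 2 / 6 : ℂ)).sub d3).sub d2).congr_deriv ?_
  rw [sub_sub_cancel]
  simp only [id]
  field_simp
  ring

theorem log_one_sub_of_im_pos {z : ℂ} (h : 0 < z.im) :
    Complex.log (1 - z) = Complex.log (z - 1) - π * I := by
  have := arg_neg_eq_arg_sub_pi_of_im_pos (x := z - 1) (by simpa using h)
  rw [Complex.log, Complex.log, ← neg_sub z 1, norm_neg, this]
  push_cast
  ring

theorem log_one_sub_of_im_neg {z : ℂ} (h : z.im < 0) :
    Complex.log (1 - z) = Complex.log (z - 1) + π * I := by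
  have := arg_neg_eq_arg_add_pi_of_im_neg (x := z - 1) (by simpa using h)
  rw [Complex.log, Complex.log, ← neg_sub z 1, norm_neg, this]
  push_cast
  ring

theorem dilog_of_im_pos {z : ℂ} (h : 0 < z.im) : dilog z = dilogUp z := by
  have := dilog_add_dilog_one_sub (cutDomain_of_im_ne_zero h.ne')
  rw [dilogUp, ← log_one_sub_of_im_pos h]
  linear_combination this

theorem dilog_of_im_neg {z : ℂ} (h : z.im < 0) :
    dilog z = dilogUp z - 2 * π * I * Complex.log z := by
  have := dilog_add_dilog_one_sub (cutDomain_of_im_ne_zero h.ne)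
  rw [log_one_sub_of_im_neg h] at this
  rw [dilogUp]
  linear_combination this

theorem li2_above_eq_dilogUp {x : ℝ} (hx : 1 < x) :
    (CutPlane.above x (.inr hx)).li2 = dilogUp x := by
  rw [CutPlane.li2_above]
  refine tendsto_nhds_unique (CutPlane.tendsto_dilog_above x) ?_
  have hc : Continuous fun t : ℝ => (x + t * I : ℂ) := by fun_prop
  have hc1 : Tendsto (fun t : ℝ => (x + t * I : ℂ)) (𝓝[>] 0) (𝓝 x) := by
    simpa using (hc.tendsto 0).mono_left nhdsWithin_le_nhds
  refine ((hasDerivAt_dilogUp (z := x) (by simpa)).continuousAt.tendsto.comp hc1).congr' ?_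
  filter_upwards [self_mem_nhdsWithin] with t ht
  exact (dilog_of_im_pos (by simpa using ht)).symm

theorem li2_below_eq_dilogUp {x : ℝ} (hx : 1 < x) :
    (CutPlane.below x (.inr hx)).li2 = dilogUp x - 2 * π * I * Complex.log x := by
  rw [CutPlane.li2_below]
  refine tendsto_nhds_unique (CutPlane.tendsto_dilog_below x) ?_
  have hc : Continuous fun t : ℝ => (x - t * I : ℂ) := by fun_prop
  have hc1 : Tendsto (fun t : ℝ => (x - t * I : ℂ)) (𝓝[>] 0) (𝓝 x) := by
    simpa using (hc.tendsto 0).mono_left nhdsWithin_le_nhds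
  have hx0 : (x : ℂ) ∈ slitPlane := Or.inl (by simp; linarith)
  have hcont : ContinuousAt (fun z : ℂ => dilogUp z - 2 * π * I * Complex.log z) x :=
    (hasDerivAt_dilogUp (z := x) (by simpa)).continuousAt.sub
      (continuousAt_const.mul (continuousAt_clog hx0))
  refine (hcont.tendsto.comp hc1).congr' ?_
  filter_upwards [self_mem_nhdsWithin] with t ht
  exact (dilog_of_im_neg (by simpa using ht)).symm


/-! ### Continuity of the logarithms on the doubled cut plane. -/

namespace CutPlane

theorem continuous_of_comp {X : Type*} [TopologicalSpace X] {f : CutPlane → X}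
    (h₁ : Continuous fun z => f (ofUpper z)) (h₂ : Continuous fun z => f (ofLower z)) :
    Continuous f :=
  continuous_sup_dom.2 ⟨continuous_coinduced_dom.2 h₁, continuous_coinduced_dom.2 h₂⟩

theorem toComplex_ofUpper (z : {z : ℂ // 0 ≤ z.im ∧ z ≠ 0 ∧ z ≠ 1}) :
    (ofUpper z).toComplex = z.1 := by
  unfold ofUpper
  split_ifs with h
  · exact Complex.ext (by simp [toComplex]) (by simp [toComplex, h.1])
  · rfl

theorem toComplex_ofLower (z : {z : ℂ // z.im ≤ 0 ∧ z ≠ 0 ∧ z ≠ 1}) :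
    (ofLower z).toComplex = z.1 := by
  unfold ofLower
  split_ifs with h
  · exact Complex.ext (by simp [toComplex]) (by simp [toComplex, h.1])
  · rfl

theorem continuous_toComplex : Continuous toComplex := by
  refine continuous_of_comp ?_ ?_
  · simp only [toComplex_ofUpper]
    exact continuous_subtype_val
  · simp only [toComplex_ofLower]
    exact continuous_subtype_val

theorem ofReal_re_of_im_eq_zero {z : ℂ} (h : z.im = 0) : (z.re : ℂ) = z :=
  Complex.ext (by simp) (by simp [h])

theorem log_ofUpper (z : {z : ℂ // 0 ≤ z.im ∧ z ≠ 0 ∧ z ≠ 1}) :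
    (ofUpper z).log = Complex.log z.1 := by
  unfold ofUpper
  split_ifs with h
  · rw [log_above, ofReal_re_of_im_eq_zero h.1]
  · rfl

theorem log_conj_of_mem_slitPlane {z : ℂ} (h : z ∈ slitPlane) :
    conj (Complex.log (conj z)) = Complex.log z := by
  rw [Complex.log_conj z (mem_slitPlane_iff_arg.1 h).1, conj_conj]

/-- The principal argument is `π` on the negative axis, the limit from above; conjugating twice
gives the limit from below. -/
theorem log_ofLower (z : {z : ℂ // z.im ≤ 0 ∧ z ≠ 0 ∧ z ≠ 1}) :
    (ofLower z).log = conj (Complex.log (conj z.1)) := by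
  unfold ofLower
  split_ifs with h
  · rw [log_below, ofReal_re_of_im_eq_zero h.1, conj_eq_iff_im.2 h.1]
  · exact (log_conj_of_mem_slitPlane (mem_cutDomain_iff.1
      (mem_cutDomain_of_not z.2.2.1 z.2.2.2 h)).1).symm

theorem logOneSub_ofUpper (z : {z : ℂ // 0 ≤ z.im ∧ z ≠ 0 ∧ z ≠ 1}) :
    (ofUpper z).logOneSub = conj (Complex.log (conj (1 - z.1))) := by
  unfold ofUpper
  split_ifs with h
  · rw [logOneSub_above, ofReal_re_of_im_eq_zero h.1,
      (conj_eq_iff_im (z := 1 - z.1)).2 (by simp [h.1])]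
  · exact (log_conj_of_mem_slitPlane (mem_cutDomain_iff.1
      (mem_cutDomain_of_not z.2.2.1 z.2.2.2 h)).2).symm

theorem logOneSub_ofLower (z : {z : ℂ // z.im ≤ 0 ∧ z ≠ 0 ∧ z ≠ 1}) :
    (ofLower z).logOneSub = Complex.log (1 - z.1) := by
  unfold ofLower
  split_ifs with h
  · rw [logOneSub_below, ofReal_re_of_im_eq_zero h.1]
  · rfl

theorem continuous_log_of_im_nonneg {X : Type*} [TopologicalSpace X] {f : X → ℂ}
    (hf : Continuous f) (h0 : ∀ x, f x ≠ 0) (him : ∀ x, 0 ≤ (f x).im) :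
    Continuous fun x => Complex.log (f x) := by
  refine continuous_iff_continuousAt.2 fun x => ?_
  by_cases h : f x ∈ slitPlane
  · exact (continuousAt_clog h).comp hf.continuousAt
  · rw [mem_slitPlane_iff, not_or, not_lt, not_not] at h
    have hre : (f x).re < 0 :=
      lt_of_le_of_ne h.1 fun e => h0 x (Complex.ext e h.2)
    exact (continuousWithinAt_log_of_re_neg_of_im_zero hre h.2).tendsto.comp
      (tendsto_nhdsWithin_iff.2 ⟨hf.continuousAt, Eventually.of_forall him⟩)

theorem continuous_log : Continuous log := by
  refine continuous_of_comp ?_ ?_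
  · simp only [log_ofUpper]
    exact continuous_log_of_im_nonneg continuous_subtype_val (fun z => z.2.2.1) fun z => z.2.1
  · simp only [log_ofLower]
    refine continuous_conj.comp (continuous_log_of_im_nonneg
      (continuous_conj.comp continuous_subtype_val) (fun z => ?_) fun z => ?_)
    · simpa using z.2.2.1
    · simpa using z.2.1

theorem continuous_logOneSub : Continuous logOneSub := by
  refine continuous_of_comp ?_ ?_
  · simp only [logOneSub_ofUpper]
    refine continuous_conj.comp (continuous_log_of_im_nonneg
      (continuous_conj.comp (continuous_const.sub continuous_subtype_val))
      (fun z => ?_) fun z => ?_)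
    · exact (map_ne_zero _).2 (sub_ne_zero.2 z.2.2.2.symm)
    · simpa using z.2.1
  · simp only [logOneSub_ofLower]
    refine continuous_log_of_im_nonneg (continuous_const.sub continuous_subtype_val)
      (fun z => ?_) fun z => ?_
    · simpa [sub_eq_zero] using z.2.2.2.symm
    · simpa using z.2.1

theorem exp_log (a : CutPlane) : Complex.exp a.log = a.toComplex := by
  rcases a with ⟨z, hz⟩ | ⟨x, hx⟩ | ⟨x, hx⟩
  · exact Complex.exp_log (slitPlane_ne_zero (mem_cutDomain_iff.1 hz).1)
  · rw [log_above, Complex.exp_log (by exact_mod_cast ne_zero_of_cut hx)]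
    rfl
  · rw [log_below, exp_conj, Complex.exp_log (by exact_mod_cast ne_zero_of_cut hx), conj_ofReal]
    rfl

theorem exp_logOneSub (a : CutPlane) : Complex.exp a.logOneSub = 1 - a.toComplex := by
  have hne : ∀ x : ℝ, x < 0 ∨ 1 < x → (1 - x : ℂ) ≠ 0 := fun x hx => by
    rw [sub_ne_zero]
    exact_mod_cast (ne_one_of_cut hx).symm
  rcases a with ⟨z, hz⟩ | ⟨x, hx⟩ | ⟨x, hx⟩
  · exact Complex.exp_log (slitPlane_ne_zero (mem_cutDomain_iff.1 hz).2)
  · rw [logOneSub_above, exp_conj, Complex.exp_log (hne x hx)]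
    simp [toComplex]
  · rw [logOneSub_below, Complex.exp_log (hne x hx)]
    rfl

end CutPlane

/-! ### Rigidity of logarithms and the coordinates of the cover. -/

theorem eq_of_exp_eq_of_abs_im_sub_lt {a b : ℂ} (h : Complex.exp a = Complex.exp b)
    (him : |(a - b).im| < 2 * π) : a = b := by
  obtain ⟨n, hn⟩ := Complex.exp_eq_exp_iff_exists_int.1 h
  have hab : a - b = n * (2 * π * I) := by
    rw [hn]
    ring
  have hi : ((n : ℂ) * (2 * π * I)).im = n * (2 * π) := by simp
  rw [hab, hi, abs_mul, abs_of_pos Real.two_pi_pos] at him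
  have hn1 : |(n : ℝ)| < 1 := by
    have := Real.two_pi_pos
    by_contra! h
    nlinarith
  have hn0 : n = 0 := by
    rw [← Int.abs_lt_one_iff]
    exact_mod_cast hn1
  rw [hn, hn0]
  simp

/-- The difference takes values in `2πiℤ` and tends to `0`. This turns multiplicative identities
into local identities between logarithms. -/
theorem eventually_eq_of_exp_eq {X : Type*} {l : Filter X} {f g : X → ℂ} {c : ℂ}
    (hf : Tendsto f l (𝓝 c)) (hg : Tendsto g l (𝓝 c))
    (he : ∀ᶠ x in l, Complex.exp (f x) = Complex.exp (g x)) : ∀ᶠ x in l, f x = g x := by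
  have h : Tendsto (fun x => |(f x - g x).im|) l (𝓝 0) := by
    have := ((continuous_im.tendsto _).comp (hf.sub hg)).abs
    simpa using this
  filter_upwards [h.eventually_lt_const Real.two_pi_pos, he] with x hx hex
  exact eq_of_exp_eq_of_abs_im_sub_lt hex hx

namespace Cover

theorem continuous_proj : Continuous proj :=
  continuous_quot_lift _ (CutPlane.continuous_toComplex.comp continuous_fst)

theorem continuous_w0 : Continuous w0 := by
  refine continuous_quot_lift _ ?_
  have h : Continuous fun n : ℤ => (n : ℂ) := continuous_of_discreteTopology
  exact (CutPlane.continuous_log.comp continuous_fst).add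
    (continuous_const.mul (h.comp (continuous_fst.comp continuous_snd)))

theorem continuous_w1 : Continuous w1 := by
  refine continuous_quot_lift _ ?_
  have h : Continuous fun n : ℤ => (n : ℂ) := continuous_of_discreteTopology
  exact (CutPlane.continuous_logOneSub.comp continuous_fst).neg.add
    (continuous_const.mul (h.comp (continuous_snd.comp continuous_snd)))

theorem w0_mk (a : CutPlane) (p q : ℤ) : (mk a p q).w0 = a.log + 2 * π * I * p := rfl

theorem w1_mk (a : CutPlane) (p q : ℤ) : (mk a p q).w1 = -a.logOneSub + 2 * π * I * q := rfl

theorem proj_mk (a : CutPlane) (p q : ℤ) : (mk a p q).proj = a.toComplex := rfl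

theorem exists_mk (c : Cover) : ∃ a p q, c = mk a p q := by
  obtain ⟨⟨a, p, q⟩, rfl⟩ := Quot.exists_rep c
  exact ⟨a, p, q, rfl⟩

theorem exp_int_mul (n : ℤ) : Complex.exp (2 * π * I * n) = 1 := by
  rw [mul_comm]
  exact Complex.exp_int_mul_two_pi_mul_I n

theorem exp_w0 (c : Cover) : Complex.exp c.w0 = c.proj := by
  obtain ⟨a, p, q, rfl⟩ := exists_mk c
  rw [w0_mk, Complex.exp_add, exp_int_mul, mul_one, CutPlane.exp_log, proj_mk]

theorem exp_neg_w1 (c : Cover) : Complex.exp (-c.w1) = 1 - c.proj := by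
  obtain ⟨a, p, q, rfl⟩ := exists_mk c
  have : -(mk a p q).w1 = a.logOneSub + 2 * π * I * (-q : ℤ) := by
    rw [w1_mk]
    push_cast
    ring
  rw [this, Complex.exp_add, exp_int_mul, mul_one, CutPlane.exp_logOneSub, proj_mk]

theorem proj_ne_zero (c : Cover) : c.proj ≠ 0 := by
  rw [← exp_w0]
  exact Complex.exp_ne_zero _

theorem one_sub_proj_ne_zero (c : Cover) : 1 - c.proj ≠ 0 := by
  rw [← exp_neg_w1]
  exact Complex.exp_ne_zero _

end Cover

/-! ### The extended dilogarithm and its local branches. -/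

theorem Lbar_eq (a : CutPlane) (p q : ℤ) :
    Lbar a p q = a.li2 + 2 * π * I * q * (Cover.mk a p q).w0
      - 1 / 2 * (Cover.mk a p q).w0 * (Cover.mk a p q).w1 - π ^ 2 / 6 := by
  rw [Lbar, Cover.w0_mk, Cover.w1_mk]
  ring

theorem mk_eq_mk_of_eq_add {a b : ℂ} (n : ℤ) (h : a = b + (2 * π * I) ^ 2 * n) :
    (QuotientAddGroup.mk a : ℂ ⧸ Z2) = QuotientAddGroup.mk b := by
  rw [eq_comm, QuotientAddGroup.eq]
  refine AddSubgroup.mem_zmultiples_iff.2 ⟨n, ?_⟩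
  rw [h, zsmul_eq_mul]
  ring

/-- Glued triples have the same `w0` and `w1`, so by `Lbar_eq` only `li2 + 2πi q w0` has to be
compared. Across the negative axis `dilog` is continuous and `q` is unchanged; across `(1, ∞)` the
discrepancy is `(2πi)² p`. -/
theorem Lbar_glue {a b : CutPlane × ℤ × ℤ} (h : Glue a b) :
    (QuotientAddGroup.mk (Lbar a.1 a.2.1 a.2.2) : ℂ ⧸ Z2)
      = QuotientAddGroup.mk (Lbar b.1 b.2.1 b.2.2) := by
  have hs : Cover.mk a.1 a.2.1 a.2.2 = Cover.mk b.1 b.2.1 b.2.2 := Quot.sound h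
  rw [Lbar_eq, Lbar_eq, hs]
  obtain ⟨x, hx, p, q⟩ | ⟨x, hx, p, q⟩ := h
  · have h : dilog (x : ℂ) = conj (dilog x) := by
      have h1 := CutPlane.tendsto_dilog_below x
      have h2 := CutPlane.tendsto_dilog_above x
      have hc : ContinuousAt dilog x :=
        (hasDerivAt_dilog_integral (Or.inl (by simp; linarith))).continuousAt
      refine tendsto_nhds_unique (hc.tendsto.comp ?_) h2
      have hc : Continuous fun t : ℝ => (x + t * I : ℂ) := by fun_prop
      simpa using (hc.tendsto 0).mono_left (nhdsWithin_le_nhds (s := Set.Ioi 0))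
    simp only [CutPlane.li2_above, CutPlane.li2_below, ← h]
  · refine mk_eq_mk_of_eq_add (-p) ?_
    simp only [li2_above_eq_dilogUp hx, li2_below_eq_dilogUp hx, Cover.w0_mk, CutPlane.log_below]
    rw [← ofReal_log (by linarith), conj_ofReal]
    push_cast
    ring

/-- The extended Rogers dilogarithm. -/
noncomputable def Lhat : Cover → ℂ ⧸ Z2 :=
  Quot.lift (fun a => QuotientAddGroup.mk (Lbar a.1 a.2.1 a.2.2)) fun _ _ => Lbar_glue

theorem Lhat_mk (a : CutPlane) (p q : ℤ) :
    Lhat (Cover.mk a p q) = QuotientAddGroup.mk (Lbar a p q) := rfl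

theorem eq_of_two_pi_mul_eq {m n : ℤ} (h : (2 * π * I * m : ℂ) = 2 * π * I * n) : m = n := by
  exact_mod_cast mul_left_cancel₀ two_pi_I_ne_zero h

theorem mk_shift_sheet (g : ℂ) (p q : ℤ) (w0 w1 l : ℂ) (hw : w0 = l + 2 * π * I * p) :
    (QuotientAddGroup.mk (g - 2 * π * I * l + 2 * π * I * ((q + 1 : ℤ) : ℂ) * w0
      - 1 / 2 * w0 * w1 - π ^ 2 / 6) : ℂ ⧸ Z2)
      = QuotientAddGroup.mk (g + 2 * π * I * q * w0 - 1 / 2 * w0 * w1 - π ^ 2 / 6) := by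
  refine mk_eq_mk_of_eq_add p ?_
  rw [hw]
  push_cast
  ring

theorem log_one_sub_of_one_lt {x : ℝ} (hx : 1 < x) :
    Complex.log ((1 - x : ℝ) : ℂ) = Complex.log (x - 1) + π * I := by
  have h : (x - 1 : ℂ) = ((x - 1 : ℝ) : ℂ) := by push_cast; rfl
  rw [h, Complex.log, Complex.log, arg_ofReal_of_neg (by linarith : 1 - x < 0),
    arg_ofReal_of_nonneg (by linarith), norm_real, norm_real, norm_sub_rev]
  simp

/-- Off the ray `[1, ∞)`, the extended dilogarithm is given by the principal branch. -/
theorem Lhat_eq_of_one_sub_mem_slitPlane (y : Cover) (q : ℤ) (h : 1 - y.proj ∈ slitPlane)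
    (hq : y.w1 = -Complex.log (1 - y.proj) + 2 * π * I * q) :
    Lhat y = QuotientAddGroup.mk (dilog y.proj + 2 * π * I * q * y.w0
      - 1 / 2 * y.w0 * y.w1 - π ^ 2 / 6) := by
  obtain ⟨a, p, q', rfl⟩ := Cover.exists_mk y
  have key : a.logOneSub = Complex.log (1 - a.toComplex) ∧ a.li2 = dilog a.toComplex := by
    rcases a with ⟨z, hz⟩ | ⟨x, hx⟩ | ⟨x, hx⟩
    · exact ⟨rfl, rfl⟩
    -- The hypothesis leaves only `x < 0`, where both functions are continuous and the one-sided
    -- limits are values.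
    · have h' : (1 - x : ℂ) ∈ slitPlane := h
      have hc : Continuous fun t : ℝ => (x + t * I : ℂ) := by fun_prop
      have hc1 : Tendsto (fun t : ℝ => (x + t * I : ℂ)) (𝓝[>] 0) (𝓝 x) := by
        simpa using (hc.tendsto 0).mono_left (nhdsWithin_le_nhds (s := Set.Ioi 0))
      exact ⟨((hasDerivAt_log_one_sub h').continuousAt.tendsto.comp hc1).limUnder_eq,
        ((hasDerivAt_dilog_integral h').continuousAt.tendsto.comp hc1).limUnder_eq⟩
    · exact ⟨CutPlane.logOneSub_below x hx, CutPlane.li2_below x hx⟩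
  rw [Cover.w1_mk, key.1, Cover.proj_mk, add_right_inj] at hq
  rw [Lhat_mk, Lbar_eq, ← eq_of_two_pi_mul_eq hq, key.2, Cover.proj_mk]

/-- Near the ray `(1, ∞)`, the extended dilogarithm is given by the continuation `dilogUp`. -/
theorem Lhat_eq_of_one_lt_re (y : Cover) (q : ℤ) (h : 1 < y.proj.re)
    (hq : y.w1 = -(Complex.log (y.proj - 1) - π * I) + 2 * π * I * q) :
    Lhat y = QuotientAddGroup.mk (dilogUp y.proj + 2 * π * I * q * y.w0
      - 1 / 2 * y.w0 * y.w1 - π ^ 2 / 6) := by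
  obtain ⟨a, p, q', rfl⟩ := Cover.exists_mk y
  -- The first alternative covers the upper side of the ray, the second the lower side, where
  -- `dilog` differs from its continuation by `2πi log z`.
  have key : (a.logOneSub = Complex.log (a.toComplex - 1) - π * I ∧ a.li2 = dilogUp a.toComplex) ∨
      (a.logOneSub = Complex.log (a.toComplex - 1) + π * I ∧
        a.li2 = dilogUp a.toComplex - 2 * π * I * a.log) := by
    rcases a with ⟨z, hz⟩ | ⟨x, hx⟩ | ⟨x, hx⟩
    · have h' : 1 < z.re := h
      have him : z.im ≠ 0 := fun e => hz ⟨e, Or.inr h'.le⟩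
      rcases lt_or_gt_of_ne him with him | him
      · exact Or.inr ⟨log_one_sub_of_im_neg him, dilog_of_im_neg him⟩
      · exact Or.inl ⟨log_one_sub_of_im_pos him, dilog_of_im_pos him⟩
    · have h' : 1 < x := h
      refine Or.inl ⟨?_, li2_above_eq_dilogUp h'⟩
      have hl := Cover.log_glue_neg (1 - x) (by linarith)
      have hl2 : Complex.log ((1 - x : ℝ) : ℂ) = Complex.log (x - 1) + π * I :=
        log_one_sub_of_one_lt h'
      rw [CutPlane.logOneSub_above]
      push_cast at hl hl2
      show _ = Complex.log ((x : ℂ) - 1) - π * I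
      linear_combination hl2 - hl
    · have h' : 1 < x := h
      refine Or.inr ⟨?_, ?_⟩
      · rw [CutPlane.logOneSub_below]
        have := log_one_sub_of_one_lt h'
        push_cast at this
        exact this
      · rw [li2_below_eq_dilogUp h', CutPlane.log_below, ← ofReal_log (by linarith), conj_ofReal]
        rfl
  rw [Cover.w1_mk, Cover.proj_mk] at hq
  rw [Lhat_mk, Lbar_eq, Cover.proj_mk]
  rcases key with ⟨h1, h2⟩ | ⟨h1, h2⟩
  · rw [h1, add_right_inj] at hq
    rw [← eq_of_two_pi_mul_eq hq, h2]
  -- On the lower side `Log (1 - z)` exceeds the continued branch by `2πi`, so the same `w1` needs a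
  -- sheet index larger by one.
  · have hq' : q' = q + 1 := by
      refine eq_of_two_pi_mul_eq ?_
      rw [h1] at hq
      push_cast
      linear_combination hq
    rw [hq', h2]
    exact mk_shift_sheet _ p q _ _ _ (Cover.w0_mk _ _ _)


/-! ### Local primitives on the cover. -/

/-- At the point `z`, the functions `u` and `v` are branches of `log z` and `-log (1 - z)`, and `g`
is a primitive of `(v du - u dv) / 2`. -/
structure IsRogersAt (u v g : ℂ → ℂ) (z : ℂ) : Prop where
  exp_left : Complex.exp (u z) = z
  exp_right : Complex.exp (-v z) = 1 - z
  left : HasDerivAt u (1 / z) z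
  right : HasDerivAt v (1 / (1 - z)) z
  prim : HasDerivAt g (1 / 2 * (v z * (1 / z) - u z * (1 / (1 - z)))) z

/-- Since `D' = -l / z`, the derivative of `D + 2πi q u` is `v / z`; subtracting half the derivative
of `u v` leaves the antisymmetric form. -/
theorem isRogersAt_of_primitive {u l D : ℂ → ℂ} {q : ℤ} {z : ℂ} (hue : Complex.exp (u z) = z)
    (hle : Complex.exp (l z) = 1 - z) (hu : HasDerivAt u (1 / z) z)
    (hl : HasDerivAt l (-(1 / (1 - z))) z) (hD : HasDerivAt D (-l z / z) z) :
    IsRogersAt u (fun z => -l z + 2 * π * I * q) (fun z => D z + 2 * π * I * q * u z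
      - 1 / 2 * u z * (-l z + 2 * π * I * q) - π ^ 2 / 6) z := by
  have hv : HasDerivAt (fun z => -l z + 2 * π * I * q) (1 / (1 - z)) z := by
    simpa using hl.neg.add_const (2 * π * I * q)
  refine ⟨hue, ?_, hu, hv, ?_⟩
  · have : -(-l z + 2 * π * I * q) = l z + 2 * π * I * (-q : ℤ) := by
      push_cast
      ring
    rw [this, Complex.exp_add, Cover.exp_int_mul, mul_one, hle]
  · refine (((hD.add (hu.const_mul (2 * π * I * q))).sub
      ((hu.const_mul (1 / 2)).mul hv)).sub_const (π ^ 2 / 6 : ℂ)).congr_deriv ?_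
    ring

theorem Cover.exists_isRogersAt_of_primitive (c : Cover) {l D : ℂ → ℂ}
    (hle : ∀ᶠ z in 𝓝 c.proj, Complex.exp (l z) = 1 - z)
    (hl : ∀ᶠ z in 𝓝 c.proj, HasDerivAt l (-(1 / (1 - z))) z)
    (hD : ∀ᶠ z in 𝓝 c.proj, HasDerivAt D (-l z / z) z)
    (hL : ∀ q : ℤ, ∀ᶠ y in 𝓝 c, y.w1 = -l y.proj + 2 * π * I * q →
      Lhat y = QuotientAddGroup.mk (D y.proj + 2 * π * I * q * y.w0
        - 1 / 2 * y.w0 * y.w1 - π ^ 2 / 6)) :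
    ∃ u v g : ℂ → ℂ, (∀ᶠ z in 𝓝 c.proj, IsRogersAt u v g z) ∧
      ∀ᶠ y in 𝓝 c, y.w0 = u y.proj ∧ y.w1 = v y.proj ∧ Lhat y = QuotientAddGroup.mk (g y.proj) := by
  obtain ⟨n, hn⟩ : ∃ n : ℤ, l c.proj = -c.w1 + n * (2 * π * I) :=
    Complex.exp_eq_exp_iff_exists_int.1 (by rw [hle.self_of_nhds, c.exp_neg_w1])
  -- Dividing by the base point centres the logarithm at `1`, away from its cut, wherever the base
  -- point lies.
  set u : ℂ → ℂ := fun z => c.w0 + Complex.log (z / c.proj) with hu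
  have h0 := c.proj_ne_zero
  have huc : u c.proj = c.w0 := by simp [hu, div_self h0]
  have hslit : ∀ᶠ z in 𝓝 c.proj, z / c.proj ∈ slitPlane := by
    have hc : Continuous fun z : ℂ => z / c.proj := by fun_prop
    exact hc.continuousAt.eventually_mem (isOpen_slitPlane.mem_nhds (by simp [div_self h0]))
  have hdu : ∀ z, z / c.proj ∈ slitPlane → HasDerivAt u (1 / z) z := by
    intro z hz
    have hz0 : z ≠ 0 := by
      rintro rfl
      simp at hz
    refine ((((hasDerivAt_id z).div_const c.proj).clog hz).const_add c.w0).congr_deriv ?_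
    simp only [id]
    field_simp
  have heu : ∀ z, z / c.proj ∈ slitPlane → Complex.exp (u z) = z := by
    intro z hz
    rw [hu, Complex.exp_add, Complex.exp_log (slitPlane_ne_zero hz), c.exp_w0, mul_div_cancel₀ _ h0]
  have htend := continuous_proj.tendsto c
  refine ⟨u, fun z => -l z + 2 * π * I * n, fun z => D z + 2 * π * I * n * u z
      - 1 / 2 * u z * (-l z + 2 * π * I * n) - π ^ 2 / 6, ?_, ?_⟩
  · filter_upwards [hle, hl, hD, hslit] with z h1 h2 h3 h4
    exact isRogersAt_of_primitive (heu z h4) h1 (hdu z h4) h2 h3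
  · have e0 : ∀ᶠ y in 𝓝 c, y.w0 = u y.proj := by
      refine eventually_eq_of_exp_eq (c := c.w0) (continuous_w0.tendsto c) ?_ ?_
      · have := (hdu _ hslit.self_of_nhds).continuousAt.tendsto.comp htend
        rwa [huc] at this
      · filter_upwards [htend.eventually hslit] with y hy
        rw [y.exp_w0, heu _ hy]
    have e1 : ∀ᶠ y in 𝓝 c, y.w1 = -l y.proj + 2 * π * I * n := by
      refine eventually_eq_of_exp_eq (c := c.w1) (continuous_w1.tendsto c) ?_ ?_
      · have := ((hl.self_of_nhds.continuousAt.neg.add_const (2 * π * I * n)).tendsto).comp htend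
        have hc : (-l) c.proj + 2 * π * I * n = c.w1 := by
          rw [Pi.neg_apply, hn]
          ring
        rwa [hc] at this
      · filter_upwards [htend.eventually hle] with y hy
        rw [Complex.exp_add, Cover.exp_int_mul, mul_one, Complex.exp_neg, hy, ← y.exp_neg_w1,
          Complex.exp_neg, inv_inv]
    filter_upwards [e0, e1, hL n] with y h0 h1 h2
    refine ⟨h0, h1, ?_⟩
    rw [h2 h1, h0, h1]

/-- Near every point of the cover, the coordinates `w0`, `w1` and the extended dilogarithm are
given by holomorphic functions of the projection. -/
theorem Cover.exists_isRogersAt (c : Cover) :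
    ∃ u v g : ℂ → ℂ, (∀ᶠ z in 𝓝 c.proj, IsRogersAt u v g z) ∧
      ∀ᶠ y in 𝓝 c, y.w0 = u y.proj ∧ y.w1 = v y.proj ∧ Lhat y = QuotientAddGroup.mk (g y.proj) := by
  have htend := continuous_proj.tendsto c
  -- Off the ray the principal branch serves; on the ray the continuation `dilogUp` does.
  by_cases h : 1 - c.proj ∈ slitPlane
  · have hev : ∀ᶠ z in 𝓝 c.proj, 1 - z ∈ slitPlane := isOpen_one_sub_mem_slitPlane.mem_nhds h
    refine c.exists_isRogersAt_of_primitive (l := fun z => Complex.log (1 - z)) (D := dilog)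
      ?_ ?_ ?_ fun q => ?_
    · filter_upwards [hev] with z hz using Complex.exp_log (slitPlane_ne_zero hz)
    · filter_upwards [hev] with z hz using hasDerivAt_log_one_sub hz
    · filter_upwards [hev, isOpen_ne.mem_nhds c.proj_ne_zero] with z hz hz0
      exact hasDerivAt_dilog hz hz0
    · filter_upwards [htend.eventually hev] with y hy hq
      exact Lhat_eq_of_one_sub_mem_slitPlane y q hy hq
  · have hre : 1 < c.proj.re := by
      rw [mem_slitPlane_iff, not_or, not_lt, not_not] at h
      refine lt_of_le_of_ne (by simpa using h.1) fun e => c.one_sub_proj_ne_zero ?_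
      exact Complex.ext (by simp [← e]) h.2
    have hev : ∀ᶠ z : ℂ in 𝓝 c.proj, 1 < z.re :=
      continuous_re.continuousAt.eventually_mem (Ioi_mem_nhds hre)
    have hsl : ∀ z : ℂ, 1 < z.re → z - 1 ∈ slitPlane := fun z hz => Or.inl (by simpa using hz)
    refine c.exists_isRogersAt_of_primitive (l := fun z => Complex.log (z - 1) - π * I)
      (D := dilogUp) ?_ ?_ ?_ fun q => ?_
    · filter_upwards [hev] with z hz
      rw [Complex.exp_sub, Complex.exp_log (slitPlane_ne_zero (hsl z hz)), Complex.exp_pi_mul_I]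
      ring
    · filter_upwards [hev] with z hz
      refine ((((hasDerivAt_id z).sub_const 1).clog (hsl z hz)).sub_const (π * I)).congr_deriv ?_
      rw [← neg_sub z 1, one_div_neg_eq_neg_one_div, neg_neg]
      rfl
    · filter_upwards [hev] with z hz using hasDerivAt_dilogUp hz
    · filter_upwards [htend.eventually hev] with y hy hq
      exact Lhat_eq_of_one_lt_re y q hy hq

theorem isHolomorphic_Lhat : Cover.IsHolomorphic Lhat := by
  intro c
  obtain ⟨u, v, g, h1, h2⟩ := c.exists_isRogersAt
  refine ⟨g, ?_, h2.mono fun y hy => hy.2.2⟩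
  exact analyticAt_iff_eventually_differentiableAt.2 (h1.mono fun z hz => hz.prim.differentiableAt)

/-! ### The lifted five term relation -/

/-- The linear relations between the lifted logarithms of the entries of a five term relation. -/
structure FiveRel (u v : Fin 5 → ℂ) : Prop where
  u2 : u 2 = u 1 - u 0
  u4 : u 4 = v 1 - v 0
  u3 : u 3 = u 2 + u 4
  v3 : v 3 = v 2 - v 1
  v4 : v 4 = v 3 - u 0

/-- The entries of the five term relation with parameters `(x, y)`. -/
noncomputable def fiveTerm (e : ℂ × ℂ) : Fin 5 → ℂ :=
  ![e.1, e.2, e.2 / e.1, (1 - 1 / e.1) / (1 - 1 / e.2), (1 - e.1) / (1 - e.2)]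

theorem one_sub_fiveTerm_three {e : ℂ × ℂ} (hx : e.1 ≠ 0) (hy : e.2 ≠ 0) (hy1 : 1 - e.2 ≠ 0) :
    1 - fiveTerm e 3 = (e.1 - e.2) / (e.1 * (1 - e.2)) := by
  have hy' : e.2 - 1 ≠ 0 := by
    rw [← neg_sub]
    exact neg_ne_zero.2 hy1
  have h : (1 - 1 / e.2 : ℂ) ≠ 0 := by
    rw [one_sub_div hy]
    exact div_ne_zero hy' hy
  have : fiveTerm e 3 = (1 - 1 / e.1) / (1 - 1 / e.2) := rfl
  rw [this, one_sub_div hx, one_sub_div hy]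
  field_simp
  ring

/-- The entries satisfy `z₂ = y / x`, `z₄ = (1 - x) / (1 - y)`, `z₃ = z₂ z₄`, `1 - z₃ = (1 - z₂) /
(1 - y)` and `1 - z₄ = x (1 - z₃)`. All denominators are nonzero because they are expressed by
exponentials. -/
theorem exp_fiveRel {e : ℂ × ℂ} {u v : Fin 5 → ℂ} (hu : ∀ k, Complex.exp (u k) = fiveTerm e k)
    (hv : ∀ k, Complex.exp (-v k) = 1 - fiveTerm e k) :
    Complex.exp (u 2) = Complex.exp (u 1 - u 0) ∧ Complex.exp (u 4) = Complex.exp (v 1 - v 0) ∧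
    Complex.exp (u 3) = Complex.exp (u 2 + u 4) ∧ Complex.exp (v 3) = Complex.exp (v 2 - v 1) ∧
    Complex.exp (v 4) = Complex.exp (v 3 - u 0) := by
  have u0 : Complex.exp (u 0) = e.1 := hu 0
  have u1 : Complex.exp (u 1) = e.2 := hu 1
  have u2 : Complex.exp (u 2) = e.2 / e.1 := hu 2
  have u4 : Complex.exp (u 4) = (1 - e.1) / (1 - e.2) := hu 4
  have v0 : Complex.exp (-v 0) = 1 - e.1 := hv 0
  have v1 : Complex.exp (-v 1) = 1 - e.2 := hv 1
  have v2 : Complex.exp (-v 2) = 1 - e.2 / e.1 := hv 2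
  have v4 : Complex.exp (-v 4) = 1 - (1 - e.1) / (1 - e.2) := hv 4
  have hx : e.1 ≠ 0 := u0 ▸ Complex.exp_ne_zero _
  have hy : e.2 ≠ 0 := u1 ▸ Complex.exp_ne_zero _
  have hx1 : 1 - e.1 ≠ 0 := v0 ▸ Complex.exp_ne_zero _
  have hy1 : 1 - e.2 ≠ 0 := v1 ▸ Complex.exp_ne_zero _
  have hxy : e.1 - e.2 ≠ 0 := by
    intro h
    rw [sub_eq_zero] at h
    rw [h, div_self hy, sub_self] at v2
    exact Complex.exp_ne_zero _ v2
  have v4' : 1 - (1 - e.1) / (1 - e.2) = (e.1 - e.2) / (1 - e.2) := by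
    rw [one_sub_div hy1]
    ring
  have v3 : Complex.exp (-v 3) = (e.1 - e.2) / (e.1 * (1 - e.2)) := by
    rw [hv 3, one_sub_fiveTerm_three hx hy hy1]
  have u3 : Complex.exp (u 3) = 1 - (e.1 - e.2) / (e.1 * (1 - e.2)) := by
    rw [hu 3, ← one_sub_fiveTerm_three hx hy hy1]
    ring
  have inv : ∀ a, Complex.exp a = (Complex.exp (-a))⁻¹ := fun a => by
    rw [Complex.exp_neg, inv_inv]
  refine ⟨?_, ?_, ?_, ?_, ?_⟩
  · rw [u2, Complex.exp_sub, u0, u1]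
  · rw [u4, Complex.exp_sub, inv (v 1), inv (v 0), v0, v1]
    field_simp
  · rw [Complex.exp_add, u3, u2, u4]
    field_simp
    ring
  · rw [Complex.exp_sub, inv (v 3), inv (v 2), inv (v 1), v1, v2, v3]
    field_simp
  · rw [Complex.exp_sub, inv (v 4), inv (v 3), v3, v4, v4', u0]
    field_simp

/-- This is the infinitesimal form of `∑ (-1)ᵏ u_k ∧ v_k = 0`, a formal consequence of the five
linear relations. They are needed on a neighbourhood so that they can be differentiated. -/
theorem hasFDerivAt_alternating_sum {E : Type*} [NormedAddCommGroup E] [NormedSpace ℂ E]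
    {u v g : Fin 5 → E → ℂ} {e : E} (hu : ∀ k, DifferentiableAt ℂ (u k) e)
    (hv : ∀ k, DifferentiableAt ℂ (v k) e)
    (hg : ∀ k, HasFDerivAt (g k)
      ((1 / 2 : ℂ) • (v k e • fderiv ℂ (u k) e - u k e • fderiv ℂ (v k) e)) e)
    (h : ∀ᶠ x in 𝓝 e, FiveRel (fun k => u k x) (fun k => v k x)) :
    HasFDerivAt (fun x => ∑ k : Fin 5, (-1 : ℂ) ^ (k : ℕ) * g k x) (0 : E →L[ℂ] ℂ) e := by
  have d2 : fderiv ℂ (u 2) e = fderiv ℂ (u 1) e - fderiv ℂ (u 0) e := by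
    rw [← fderiv_sub (hu 1) (hu 0)]
    exact Filter.EventuallyEq.fderiv_eq (h.mono fun x hx => hx.u2)
  have d4 : fderiv ℂ (u 4) e = fderiv ℂ (v 1) e - fderiv ℂ (v 0) e := by
    rw [← fderiv_sub (hv 1) (hv 0)]
    exact Filter.EventuallyEq.fderiv_eq (h.mono fun x hx => hx.u4)
  have d3 : fderiv ℂ (u 3) e = fderiv ℂ (u 2) e + fderiv ℂ (u 4) e := by
    rw [← fderiv_add (hu 2) (hu 4)]
    exact Filter.EventuallyEq.fderiv_eq (h.mono fun x hx => hx.u3)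
  have c3 : fderiv ℂ (v 3) e = fderiv ℂ (v 2) e - fderiv ℂ (v 1) e := by
    rw [← fderiv_sub (hv 2) (hv 1)]
    exact Filter.EventuallyEq.fderiv_eq (h.mono fun x hx => hx.v3)
  have c4 : fderiv ℂ (v 4) e = fderiv ℂ (v 3) e - fderiv ℂ (u 0) e := by
    rw [← fderiv_sub (hv 3) (hu 0)]
    exact Filter.EventuallyEq.fderiv_eq (h.mono fun x hx => hx.v4)
  have he := h.self_of_nhds
  refine (HasFDerivAt.fun_sum fun k _ => (hg k).const_mul ((-1 : ℂ) ^ (k : ℕ))).congr_fderiv ?_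
  have r2 := he.u2
  have r4 := he.u4
  have r3 := he.u3
  have s3 := he.v3
  have s4 := he.v4
  ext x
  simp only [Fin.sum_univ_five, d3, d4, d2, c4, c3, r3, r2, r4, s4, s3]
  simp
  ring

theorem differentiableAt_fiveTerm {e : ℂ × ℂ} (hx : e.1 ≠ 0) (hy : e.2 ≠ 0) (hy1 : 1 - e.2 ≠ 0)
    (k : Fin 5) : DifferentiableAt ℂ (fun e => fiveTerm e k) e := by
  have h : (1 - 1 / e.2 : ℂ) ≠ 0 := by
    rw [one_sub_div hy, ← neg_sub]
    exact div_ne_zero (neg_ne_zero.2 hy1) hy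
  fin_cases k
  · exact differentiableAt_fst
  · exact differentiableAt_snd
  · show DifferentiableAt ℂ (fun e : ℂ × ℂ => e.2 / e.1) e
    fun_prop (disch := assumption)
  · show DifferentiableAt ℂ (fun e : ℂ × ℂ => (1 - 1 / e.1) / (1 - 1 / e.2)) e
    fun_prop (disch := assumption)
  · show DifferentiableAt ℂ (fun e : ℂ × ℂ => (1 - e.1) / (1 - e.2)) e
    fun_prop (disch := assumption)

section Local

variable {u v g : Fin 5 → ℂ → ℂ} {e : ℂ × ℂ}

theorem differentiableAt_fiveTerm_of_isRogersAt
    (h : ∀ k, IsRogersAt (u k) (v k) (g k) (fiveTerm e k)) (k : Fin 5) :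
    DifferentiableAt ℂ (fun e => fiveTerm e k) e := by
  have h0 : fiveTerm e 0 ≠ 0 := fun hz => Complex.exp_ne_zero _ ((h 0).exp_left.trans hz)
  have h1 : fiveTerm e 1 ≠ 0 := fun hz => Complex.exp_ne_zero _ ((h 1).exp_left.trans hz)
  have h2 : 1 - fiveTerm e 1 ≠ 0 := fun hz => Complex.exp_ne_zero _ ((h 1).exp_right.trans hz)
  exact differentiableAt_fiveTerm h0 h1 h2 k

theorem eventually_isRogersAt_fiveTerm
    (h : ∀ k, ∀ᶠ z in 𝓝 (fiveTerm e k), IsRogersAt (u k) (v k) (g k) z) :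
    ∀ᶠ e' in 𝓝 e, ∀ k, IsRogersAt (u k) (v k) (g k) (fiveTerm e' k) := by
  refine eventually_all.2 fun k => ?_
  exact (differentiableAt_fiveTerm_of_isRogersAt
    (fun k => (h k).self_of_nhds) k).continuousAt.eventually (h k)

/-- The defect of each relation lies in `2πiℤ`, is continuous and vanishes at `e`. -/
theorem eventually_fiveRel
    (h : ∀ k, ∀ᶠ z in 𝓝 (fiveTerm e k), IsRogersAt (u k) (v k) (g k) z)
    (hR : FiveRel (fun k => u k (fiveTerm e k)) (fun k => v k (fiveTerm e k))) :
    ∀ᶠ e' in 𝓝 e, FiveRel (fun k => u k (fiveTerm e' k)) (fun k => v k (fiveTerm e' k)) := by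
  have hd := differentiableAt_fiveTerm_of_isRogersAt fun k => (h k).self_of_nhds
  have hu : ∀ k, Tendsto (fun e' => u k (fiveTerm e' k)) (𝓝 e) (𝓝 (u k (fiveTerm e k))) :=
    fun k => (h k).self_of_nhds.left.continuousAt.tendsto.comp (hd k).continuousAt.tendsto
  have hv : ∀ k, Tendsto (fun e' => v k (fiveTerm e' k)) (𝓝 e) (𝓝 (v k (fiveTerm e k))) :=
    fun k => (h k).self_of_nhds.right.continuousAt.tendsto.comp (hd k).continuousAt.tendsto
  have hexp : ∀ᶠ e' in 𝓝 e, _ := (eventually_isRogersAt_fiveTerm h).mono fun e' he' =>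
    exp_fiveRel (fun k => (he' k).exp_left) (fun k => (he' k).exp_right)
  have r2 := hR.u2 ▸ hu 2
  have r4 := hR.u4 ▸ hu 4
  have r3 := hR.u3 ▸ hu 3
  have s3 := hR.v3 ▸ hv 3
  have s4 := hR.v4 ▸ hv 4
  filter_upwards [eventually_eq_of_exp_eq r2 ((hu 1).sub (hu 0)) (hexp.mono fun _ h => h.1),
    eventually_eq_of_exp_eq r4 ((hv 1).sub (hv 0)) (hexp.mono fun _ h => h.2.1),
    eventually_eq_of_exp_eq r3 ((hu 2).add (hu 4)) (hexp.mono fun _ h => h.2.2.1),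
    eventually_eq_of_exp_eq s3 ((hv 2).sub (hv 1)) (hexp.mono fun _ h => h.2.2.2.1),
    eventually_eq_of_exp_eq s4 ((hv 3).sub (hu 0)) (hexp.mono fun _ h => h.2.2.2.2)]
    with e' h1 h2 h3 h4 h5
  exact ⟨h1, h2, h3, h4, h5⟩

theorem hasFDerivAt_fiveTerm_sum
    (h : ∀ k, ∀ᶠ z in 𝓝 (fiveTerm e k), IsRogersAt (u k) (v k) (g k) z)
    (hR : FiveRel (fun k => u k (fiveTerm e k)) (fun k => v k (fiveTerm e k))) :
    HasFDerivAt (fun e' => ∑ k : Fin 5, (-1 : ℂ) ^ (k : ℕ) * g k (fiveTerm e' k))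
      (0 : ℂ × ℂ →L[ℂ] ℂ) e := by
  have hk := fun k => (h k).self_of_nhds
  have hd := differentiableAt_fiveTerm_of_isRogersAt hk
  have hu := fun k => (hk k).left.comp_hasFDerivAt e (hd k).hasFDerivAt
  have hv := fun k => (hk k).right.comp_hasFDerivAt e (hd k).hasFDerivAt
  have hg := fun k => (hk k).prim.comp_hasFDerivAt e (hd k).hasFDerivAt
  refine hasFDerivAt_alternating_sum (u := fun k e' => u k (fiveTerm e' k))
    (v := fun k e' => v k (fiveTerm e' k)) (g := fun k e' => g k (fiveTerm e' k))
    (fun k => (hu k).differentiableAt) (fun k => (hv k).differentiableAt) (fun k => ?_)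
    (eventually_fiveRel h hR)
  refine (hg k).congr_fderiv ?_
  have e1 : fderiv ℂ (fun e' => u k (fiveTerm e' k)) e = _ := (hu k).fderiv
  have e2 : fderiv ℂ (fun e' => v k (fiveTerm e' k)) e = _ := (hv k).fderiv
  rw [e1, e2]
  module

theorem eventually_fiveTerm_sum_eq
    (h : ∀ k, ∀ᶠ z in 𝓝 (fiveTerm e k), IsRogersAt (u k) (v k) (g k) z)
    (hR : FiveRel (fun k => u k (fiveTerm e k)) (fun k => v k (fiveTerm e k))) :
    ∀ᶠ e' in 𝓝 e, ∑ k : Fin 5, (-1 : ℂ) ^ (k : ℕ) * g k (fiveTerm e' k)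
      = ∑ k : Fin 5, (-1 : ℂ) ^ (k : ℕ) * g k (fiveTerm e k) := by
  have hd := differentiableAt_fiveTerm_of_isRogersAt fun k => (h k).self_of_nhds
  have hev : ∀ᶠ e' in 𝓝 e, HasFDerivAt
      (fun e' => ∑ k : Fin 5, (-1 : ℂ) ^ (k : ℕ) * g k (fiveTerm e' k))
      (0 : ℂ × ℂ →L[ℂ] ℂ) e' := by
    have h' : ∀ᶠ e' in 𝓝 e, ∀ k, ∀ᶠ z in 𝓝 (fiveTerm e' k), IsRogersAt (u k) (v k) (g k) z :=
      eventually_all.2 fun k => (hd k).continuousAt.eventually (h k).eventually_nhds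
    filter_upwards [h', eventually_fiveRel h hR] with e' h1 h2
    exact hasFDerivAt_fiveTerm_sum h1 h2
  obtain ⟨r, hr, hball⟩ := Metric.eventually_nhds_iff_ball.1 hev
  filter_upwards [Metric.ball_mem_nhds e hr] with e' he'
  exact Metric.isOpen_ball.is_const_of_fderiv_eq_zero (convex_ball e r).isPreconnected
    (fun x hx => (hball x hx).differentiableAt.differentiableWithinAt)
    (fun x hx => (hball x hx).fderiv) he' (Metric.mem_ball_self hr)

end Local


/-! ### The five term relation on the principal sheet -/

theorem log_im_mem_Ioo {z : ℂ} (h : 0 < z.im) : (Complex.log z).im ∈ Set.Ioo 0 π := by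
  rw [Complex.log_im]
  refine ⟨lt_of_le_of_ne (arg_nonneg_iff.2 h.le) fun e => ?_, arg_lt_pi_iff.2 (Or.inr h.ne')⟩
  exact h.ne' (arg_eq_zero_iff.1 e.symm).2

theorem neg_log_one_sub_im_mem_Ioo {z : ℂ} (h : 0 < z.im) :
    (-Complex.log (1 - z)).im ∈ Set.Ioo 0 π := by
  have h1 : (1 - z).im < 0 := by simpa using h
  have h2 := neg_pi_lt_arg (1 - z)
  have h3 := arg_neg_iff.2 h1
  rw [neg_im, Complex.log_im]
  exact ⟨by linarith, by linarith⟩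

theorem exp_neg_neg_log_one_sub {z : ℂ} (hz : z ∈ cutDomain) :
    Complex.exp (-(-Complex.log (1 - z))) = 1 - z := by
  rw [neg_neg, Complex.exp_log (slitPlane_ne_zero (mem_cutDomain_iff.1 hz).2)]

/-- All logarithms involved have imaginary part in `(0, π)`, so each defect has imaginary part of
modulus less than `2π`. -/
theorem fiveRel_log {e : ℂ × ℂ} (h : ∀ k, 0 < (fiveTerm e k).im) :
    FiveRel (fun k => Complex.log (fiveTerm e k)) (fun k => -Complex.log (1 - fiveTerm e k)) := by
  have hc : ∀ k, fiveTerm e k ∈ cutDomain := fun k => cutDomain_of_im_ne_zero (h k).ne'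
  obtain ⟨h2, h4, h3, k3, k4⟩ := exp_fiveRel (e := e)
    (u := fun k => Complex.log (fiveTerm e k)) (v := fun k => -Complex.log (1 - fiveTerm e k))
    (fun k => Complex.exp_log (slitPlane_ne_zero (mem_cutDomain_iff.1 (hc k)).1))
    (fun k => exp_neg_neg_log_one_sub (hc k))
  have hu : ∀ k, (Complex.log (fiveTerm e k)).im ∈ Set.Ioo 0 π := fun k => log_im_mem_Ioo (h k)
  have hv : ∀ k, (-Complex.log (1 - fiveTerm e k)).im ∈ Set.Ioo 0 π :=
    fun k => neg_log_one_sub_im_mem_Ioo (h k)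
  have hpi := Real.pi_pos
  refine ⟨eq_of_exp_eq_of_abs_im_sub_lt h2 ?_, eq_of_exp_eq_of_abs_im_sub_lt h4 ?_,
    eq_of_exp_eq_of_abs_im_sub_lt h3 ?_, eq_of_exp_eq_of_abs_im_sub_lt k3 ?_,
    eq_of_exp_eq_of_abs_im_sub_lt k4 ?_⟩ <;> rw [abs_lt]
  · simp only [sub_im]
    constructor <;> linarith [(hu 0).1, (hu 0).2, (hu 1).1, (hu 1).2, (hu 2).1, (hu 2).2]
  · simp only [sub_im]
    constructor <;> linarith [(hv 0).1, (hv 0).2, (hv 1).1, (hv 1).2, (hu 4).1, (hu 4).2]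
  · simp only [sub_im, add_im]
    constructor <;> linarith [(hu 3).1, (hu 3).2, (hu 2).1, (hu 2).2, (hu 4).1, (hu 4).2]
  · simp only [sub_im]
    constructor <;> linarith [(hv 3).1, (hv 3).2, (hv 1).1, (hv 1).2, (hv 2).1, (hv 2).2]
  · simp only [sub_im]
    constructor <;> linarith [(hv 3).1, (hv 3).2, (hv 4).1, (hv 4).2, (hu 0).1, (hu 0).2]

/-- The Rogers dilogarithm on the principal sheet, normalised to vanish at `1`. -/
noncomputable def rogers (z : ℂ) : ℂ :=
  dilog z + 1 / 2 * Complex.log z * Complex.log (1 - z) - π ^ 2 / 6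

theorem Lbar_inner_zero (z : ℂ) (hz : z ∈ cutDomain) : Lbar (.inner z hz) 0 0 = rogers z := by
  have h1 : (CutPlane.inner z hz).li2 = dilog z := rfl
  have h2 : (CutPlane.inner z hz).log = Complex.log z := rfl
  have h3 : (CutPlane.inner z hz).logOneSub = Complex.log (1 - z) := rfl
  rw [Lbar, h1, h2, h3, rogers]
  simp

theorem isRogersAt_rogers {z : ℂ} (hz : z ∈ cutDomain) :
    IsRogersAt Complex.log (fun z => -Complex.log (1 - z)) rogers z := by
  obtain ⟨h1, h2⟩ := mem_cutDomain_iff.1 hz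
  have h0 := slitPlane_ne_zero h1
  have h := isRogersAt_of_primitive (q := 0) (Complex.exp_log h0)
    (Complex.exp_log (slitPlane_ne_zero h2)) (by simpa using Complex.hasDerivAt_log h1)
    (hasDerivAt_log_one_sub h2) (hasDerivAt_dilog h2 h0)
  have e1 : (fun z => -Complex.log (1 - z) + 2 * π * I * ((0 : ℤ) : ℂ))
      = fun z => -Complex.log (1 - z) := by
    ext z
    simp
  have e2 : (fun z => dilog z + 2 * π * I * ((0 : ℤ) : ℂ) * Complex.log z
      - 1 / 2 * Complex.log z * (-Complex.log (1 - z) + 2 * π * I * ((0 : ℤ) : ℂ)) - π ^ 2 / 6)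
      = rogers := by
    ext z
    simp only [rogers, Int.cast_zero]
    ring
  rwa [e1, e2] at h

/-- By reflection, `rogers z = -dilog (1 - z) - Log z Log (1 - z) / 2` on the cut domain. -/
theorem tendsto_rogers_one : Tendsto rogers (𝓝[cutDomain] 1) (𝓝 0) := by
  have hc : Tendsto (fun z : ℂ => 1 - z) (𝓝 1) (𝓝 0) := by
    have : Continuous fun z : ℂ => 1 - z := by fun_prop
    simpa using this.tendsto 1
  have h1 := continuousAt_dilog_zero.tendsto.comp hc
  rw [dilog_zero] at h1
  have h2 := (h1.neg.sub (tendsto_log_mul_log_one_sub_one.const_mul (1 / 2))).mono_left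
    (nhdsWithin_le_nhds (s := cutDomain))
  rw [mul_zero, neg_zero, sub_zero] at h2
  refine h2.congr' ?_
  filter_upwards [self_mem_nhdsWithin] with z hz
  have := dilog_add_dilog_one_sub hz
  simp only [Function.comp, rogers]
  linear_combination -this

theorem im_div_pos_iff {a b : ℂ} (hb : b ≠ 0) : 0 < (a / b).im ↔ 0 < a.im * b.re - a.re * b.im := by
  have h : 0 < normSq b := normSq_pos.2 hb
  rw [Complex.div_im, ← sub_div]
  exact div_pos_iff_of_pos_right h

/-- Moving `x` towards `y` stays in `FT⁺`. For `k = 2` and `k = 4` the numerator of the imaginary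
part is affine in `x` and vanishes at `x = y`, hence scales by `1 - t`. -/
theorem im_fiveTerm_segment {x y : ℂ} (h : ∀ k, 0 < (fiveTerm (x, y) k).im) {t : ℝ} (ht : 0 ≤ t)
    (ht1 : t < 1) (k : Fin 5) : 0 < (fiveTerm (x + t * (y - x), y) k).im := by
  have hx : 0 < x.im := h 0
  have hy : 0 < y.im := h 1
  have ht' : 0 < 1 - t := by linarith
  have ne0 : ∀ {z : ℂ}, 0 < z.im → z ≠ 0 := fun {z} hz e => by simp [e] at hz
  have ne1 : ∀ {z : ℂ}, 0 < z.im → 1 - z ≠ 0 := fun {z} hz e => by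
    rw [← sub_eq_zero.1 e] at hz
    simp at hz
  have hxt : 0 < (x + t * (y - x)).im := by
    simp only [add_im, mul_im, ofReal_re, ofReal_im, sub_im, zero_mul, add_zero]
    nlinarith [mul_pos ht' hx, mul_nonneg ht hy.le]
  have three : ∀ x : ℂ, 0 < x.im → (fiveTerm (x, y) 3).im = ((y - x) / (x * (1 - y))).im := by
    intro x hx
    have := one_sub_fiveTerm_three (e := (x, y)) (ne0 hx) (ne0 hy) (ne1 hy)
    have h3 : fiveTerm (x, y) 3 = 1 + (y - x) / (x * (1 - y)) := by
      simp only at this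
      linear_combination -this
    rw [h3]
    simp
  fin_cases k
  · exact hxt
  · exact hy
  · have h2 : 0 < (y / x).im := h 2
    show 0 < (y / (x + t * (y - x))).im
    rw [im_div_pos_iff (ne0 hx)] at h2
    rw [im_div_pos_iff (ne0 hxt)]
    have := mul_pos ht' h2
    simp only [add_im, mul_im, add_re, mul_re, ofReal_re, ofReal_im, sub_im, sub_re, zero_mul]
    nlinarith
  · have h3 := h 3
    show 0 < (fiveTerm (x + t * (y - x), y) 3).im
    rw [three _ hx, im_div_pos_iff (mul_ne_zero (ne0 hx) (ne1 hy))] at h3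
    rw [three _ hxt, im_div_pos_iff (mul_ne_zero (ne0 hxt) (ne1 hy))]
    have p1 := mul_pos ht' h3
    -- For `k = 3` the numerator is `1 - t` times the original one plus this nonnegative term, `(1 -
    -- t) t |y - x|² Im y`.
    have p2 : 0 ≤ (1 - t) * (t * (((y - x).re ^ 2 + (y - x).im ^ 2) * y.im)) := by positivity
    simp only [add_im, mul_im, add_re, mul_re, ofReal_re, ofReal_im, sub_im, sub_re, zero_mul,
      one_re, one_im] at p1 p2 ⊢
    nlinarith
  · have h4 : 0 < ((1 - x) / (1 - y)).im := h 4
    show 0 < ((1 - (x + t * (y - x))) / (1 - y)).im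
    rw [im_div_pos_iff (ne1 hy)] at h4 ⊢
    have := mul_pos ht' h4
    simp only [add_im, mul_im, add_re, mul_re, ofReal_re, ofReal_im, sub_im, sub_re, zero_mul,
      one_re, one_im] at this ⊢
    nlinarith

/-- The five term relation for the Rogers dilogarithm on `FT⁺`. -/
theorem rogers_five_term {x y : ℂ} (h : ∀ k, 0 < (fiveTerm (x, y) k).im) :
    ∑ k : Fin 5, (-1 : ℂ) ^ (k : ℕ) * rogers (fiveTerm (x, y) k) = 0 := by
  set F : ℂ × ℂ → ℂ := fun e => ∑ k : Fin 5, (-1 : ℂ) ^ (k : ℕ) * rogers (fiveTerm e k) with hF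
  set γ : ℝ → ℂ × ℂ := fun t => (x + t * (y - x), y) with hγ
  have him : ∀ t : ℝ, 0 ≤ t → t < 1 → ∀ k, 0 < (fiveTerm (γ t) k).im :=
    fun t ht ht1 k => im_fiveTerm_segment h ht ht1 k
  have hy : 0 < y.im := h 1
  have hy0 : y ≠ 0 := fun e => by simp [e] at hy
  have hy1 : 1 - y ≠ 0 := fun e => by
    rw [← sub_eq_zero.1 e] at hy
    simp at hy
  have hγd : ∀ t, HasDerivAt γ (1 * (y - x), 0) t := fun t =>
    (((ofRealCLM.hasDerivAt (x := t)).mul_const (y - x)).const_add x).prodMk (hasDerivAt_const t y)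
  have hd : ∀ t : ℝ, 0 ≤ t → t < 1 → HasDerivAt (fun t => F (γ t)) 0 t := by
    intro t ht ht1
    have hFd := hasFDerivAt_fiveTerm_sum (e := γ t) (u := fun _ => Complex.log)
      (v := fun _ z => -Complex.log (1 - z)) (g := fun _ => rogers)
      (fun k => mem_of_superset
        (isOpen_cutDomain.mem_nhds (cutDomain_of_im_ne_zero (him t ht ht1 k).ne'))
        fun z hz => isRogersAt_rogers hz)
      (fiveRel_log (him t ht ht1))
    exact (hFd.restrictScalars ℝ).comp_hasDerivAt t (hγd t)
  have hconst : ∀ t : ℝ, 0 ≤ t → t < 1 → F (γ t) = F (γ 0) := by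
    intro t ht ht1
    refine constant_of_has_deriv_right_zero (f := fun t => F (γ t)) (a := 0) (b := t)
      (fun s hs => (hd s hs.1 (hs.2.trans_lt ht1)).continuousAt.continuousWithinAt)
      (fun s hs => (hd s hs.1 (hs.2.trans ht1)).hasDerivWithinAt) t ⟨ht, le_rfl⟩
  have hγ1 : γ 1 = (y, y) := by simp [hγ]
  have hz : ∀ k, Tendsto (fun t => fiveTerm (γ t) k) (𝓝[<] 1) (𝓝 (fiveTerm (y, y) k)) := by
    intro k
    have h1 : Tendsto γ (𝓝 1) (𝓝 (y, y)) := hγ1 ▸ (hγd 1).continuousAt.tendsto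
    exact ((differentiableAt_fiveTerm (e := (y, y)) hy0 hy0 hy1 k).continuousAt.tendsto.comp
      h1).mono_left nhdsWithin_le_nhds
  have hev : ∀ᶠ t : ℝ in 𝓝[<] 1, 0 ≤ t ∧ t < 1 := by
    filter_upwards [self_mem_nhdsWithin,
      mem_nhdsWithin_of_mem_nhds (Ioi_mem_nhds (zero_lt_one' ℝ))] with t h1 h2
    exact ⟨le_of_lt h2, h1⟩
  have hone : ∀ k, fiveTerm (y, y) k = 1 →
      Tendsto (fun t => rogers (fiveTerm (γ t) k)) (𝓝[<] 1) (𝓝 0) := by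
    intro k hk
    refine tendsto_rogers_one.comp (tendsto_nhdsWithin_iff.2 ⟨hk ▸ hz k, ?_⟩)
    filter_upwards [hev] with t ht using cutDomain_of_im_ne_zero (him t ht.1 ht.2 k).ne'
  have hy' : ∀ k, fiveTerm (y, y) k = y →
      Tendsto (fun t => rogers (fiveTerm (γ t) k)) (𝓝[<] 1) (𝓝 (rogers y)) := by
    intro k hk
    exact (isRogersAt_rogers (cutDomain_of_im_ne_zero hy.ne')).prim.continuousAt.tendsto.comp
      (hk ▸ hz k)
  have h1y : (1 - 1 / y : ℂ) ≠ 0 := by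
    rw [one_sub_div hy0, ← neg_sub]
    exact div_ne_zero (neg_ne_zero.2 hy1) hy0
  -- At `(y, y)` the first two terms cancel and the other three entries equal `1`, where `rogers`
  -- tends to `0`.
  have hlim : Tendsto (fun t => F (γ t)) (𝓝[<] 1) (𝓝 0) := by
    have l0 := hy' 0 rfl
    have l1 := hy' 1 rfl
    have l2 := hone 2 (div_self hy0)
    have l3 := hone 3 (div_self h1y)
    have l4 := hone 4 (div_self hy1)
    have := (((l0.sub l1).add l2).sub l3).add l4
    rw [sub_self, add_zero, sub_zero, add_zero] at this
    refine this.congr fun t => ?_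
    simp only [hF, Fin.sum_univ_five]
    simp
    ring
  have h0 : γ 0 = (x, y) := by simp [hγ]
  rw [← h0]
  refine tendsto_nhds_unique (Tendsto.congr' ?_ tendsto_const_nhds) hlim
  filter_upwards [hev] with t ht using (hconst t ht.1 ht.2).symm

/-! ### The five term relation on `F̂T` -/

theorem sum_zsmul_mk (g : Fin 5 → ℂ) :
    ∑ k : Fin 5, (-1 : ℤ) ^ (k : ℕ) • (QuotientAddGroup.mk (g k) : ℂ ⧸ Z2)
      = QuotientAddGroup.mk (∑ k : Fin 5, (-1 : ℂ) ^ (k : ℕ) * g k) := by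
  have h := map_sum (QuotientAddGroup.mk' Z2) (fun k : Fin 5 => (-1 : ℤ) ^ (k : ℕ) • g k)
    Finset.univ
  simp only [map_zsmul, QuotientAddGroup.mk'_apply] at h
  rw [← h]
  congr 1
  refine Finset.sum_congr rfl fun k _ => ?_
  rw [zsmul_eq_mul]
  push_cast
  rfl

/-- The linear relations and the five term relation for a tuple of points of the cover. -/
structure IsFiveTerm (w : Fin 5 → Cover) : Prop where
  rel : FiveRel (fun k => (w k).w0) (fun k => (w k).w1)
  sum_eq_zero : ∑ k : Fin 5, (-1 : ℤ) ^ (k : ℕ) • Lhat (w k) = 0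

theorem isClosed_fiveRel :
    IsClosed {w : Fin 5 → Cover | FiveRel (fun k => (w k).w0) (fun k => (w k).w1)} := by
  have h0 : ∀ k : Fin 5, Continuous fun w : Fin 5 → Cover => (w k).w0 :=
    fun k => Cover.continuous_w0.comp (continuous_apply k)
  have h1 : ∀ k : Fin 5, Continuous fun w : Fin 5 → Cover => (w k).w1 :=
    fun k => Cover.continuous_w1.comp (continuous_apply k)
  have := (isClosed_eq (h0 2) ((h0 1).sub (h0 0))).inter ((isClosed_eq (h0 4)
    ((h1 1).sub (h1 0))).inter ((isClosed_eq (h0 3) ((h0 2).add (h0 4))).inter ((isClosed_eq (h1 3)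
    ((h1 2).sub (h1 1))).inter (isClosed_eq (h1 4) ((h1 3).sub (h0 0))))))
  convert this using 1
  ext w
  exact ⟨fun h => ⟨h.u2, h.u4, h.u3, h.v3, h.v4⟩, fun h => ⟨h.1, h.2.1, h.2.2.1, h.2.2.2.1,
    h.2.2.2.2⟩⟩

theorem proj_eq_fiveTerm {w : Fin 5 → Cover} (hw : w ∈ preFT) (k : Fin 5) :
    (w k).proj = fiveTerm ((w 0).proj, (w 1).proj) k := by
  obtain ⟨x, y, -, -, -, -, -, h⟩ := hw
  have h0 : (w 0).proj = x := congrFun h 0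
  have h1 : (w 1).proj = y := congrFun h 1
  rw [h0, h1]
  exact congrFun h k

/-- `IsFiveTerm` is locally constant on `preFT`: where the linear relations hold they persist and
keep the sum constant, and where they fail they fail nearby because they are closed conditions. -/
theorem eventually_isFiveTerm_iff {w : Fin 5 → Cover} (hw : w ∈ preFT) :
    ∀ᶠ w' in 𝓝[preFT] w, (IsFiveTerm w ↔ IsFiveTerm w') := by
  by_cases hR : FiveRel (fun k => (w k).w0) (fun k => (w k).w1)
  · choose u v g hug hloc using fun k => (w k).exists_isRogersAt
    set e : ℂ × ℂ := ((w 0).proj, (w 1).proj) with he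
    have h : ∀ k, ∀ᶠ z in 𝓝 (fiveTerm e k), IsRogersAt (u k) (v k) (g k) z := fun k => by
      rw [he, ← proj_eq_fiveTerm hw k]
      exact hug k
    have hev : ∀ᶠ w' in 𝓝[preFT] w, ∀ k, (w' k).w0 = u k (w' k).proj ∧
        (w' k).w1 = v k (w' k).proj ∧ Lhat (w' k) = QuotientAddGroup.mk (g k (w' k).proj) := by
      refine eventually_all.2 fun k => ?_
      exact nhdsWithin_le_nhds ((continuous_apply k).continuousAt.eventually (hloc k))
    have hself := hev.self_of_nhdsWithin hw
    have hR' : FiveRel (fun k => u k (fiveTerm e k)) (fun k => v k (fiveTerm e k)) := by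
      convert hR using 2 with k k
      · rw [(hself k).1, proj_eq_fiveTerm hw k]
      · rw [(hself k).2.1, proj_eq_fiveTerm hw k]
    have hce : Tendsto (fun w' : Fin 5 → Cover => ((w' 0).proj, (w' 1).proj)) (𝓝[preFT] w) (𝓝 e) :=
      (((Cover.continuous_proj.comp (continuous_apply 0)).prodMk
        (Cover.continuous_proj.comp (continuous_apply 1))).tendsto w).mono_left nhdsWithin_le_nhds
    filter_upwards [hev, hce.eventually (eventually_fiveRel h hR'),
      hce.eventually (eventually_fiveTerm_sum_eq h hR'), self_mem_nhdsWithin] with w' h1 h2 h3 h4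
    have hsum : ∑ k : Fin 5, (-1 : ℤ) ^ (k : ℕ) • Lhat (w' k)
        = ∑ k : Fin 5, (-1 : ℤ) ^ (k : ℕ) • Lhat (w k) := by
      have e1 : ∀ k, Lhat (w' k) = QuotientAddGroup.mk
          (g k (fiveTerm ((w' 0).proj, (w' 1).proj) k)) := fun k => by
        rw [(h1 k).2.2, proj_eq_fiveTerm h4 k]
      have e2 : ∀ k, Lhat (w k) = QuotientAddGroup.mk (g k (fiveTerm e k)) := fun k => by
        rw [(hself k).2.2, proj_eq_fiveTerm hw k]
      simp only [e1, e2, sum_zsmul_mk]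
      exact congrArg _ h3
    have hRw : FiveRel (fun k => (w' k).w0) (fun k => (w' k).w1) := by
      convert h2 using 2 with k k
      · rw [(h1 k).1, proj_eq_fiveTerm h4 k]
      · rw [(h1 k).2.1, proj_eq_fiveTerm h4 k]
    exact ⟨fun h => ⟨hRw, hsum.trans h.sum_eq_zero⟩, fun h => ⟨hR, hsum.symm.trans h.sum_eq_zero⟩⟩
  · filter_upwards [nhdsWithin_le_nhds (isClosed_fiveRel.isOpen_compl.mem_nhds hR)] with w' hw'
    exact ⟨fun h => absurd h.rel hR, fun h => absurd h.rel hw'⟩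

theorem isFiveTerm_of_mem_FThatPlus {w : Fin 5 → Cover} (hw : w ∈ FThatPlus) : IsFiveTerm w := by
  obtain ⟨z, ⟨⟨x, y, -, -, -, -, -, hz⟩, him⟩, h, rfl⟩ := hw
  replace hz : z = fiveTerm (x, y) := hz
  subst hz
  constructor
  · convert fiveRel_log him using 2 with k k
    · rw [Cover.w0_mk, Int.cast_zero, mul_zero, add_zero]
      rfl
    · rw [Cover.w1_mk, Int.cast_zero, mul_zero, add_zero]
      rfl
  · simp only [Lhat_mk, Lbar_inner_zero, sum_zsmul_mk, rogers_five_term him]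
    rfl

/-- A locally constant property is constant on a preconnected set. Each component comes with its own
base point in `FThatPlus`, so connectedness of `FThatPlus` plays no role. -/
theorem isFiveTerm_of_mem_FThat {w : Fin 5 → Cover} (hw : w ∈ FThat) : IsFiveTerm w := by
  obtain ⟨a, ha, hwa⟩ := hw
  have hap : a ∈ preFT := by
    by_contra h
    rw [connectedComponentIn_eq_empty h] at hwa
    exact hwa
  have hsub := connectedComponentIn_subset preFT a
  have := (isPreconnected_connectedComponentIn (F := preFT) (x := a)).induction₂
    (fun w w' => IsFiveTerm w ↔ IsFiveTerm w')
    (fun w hw => nhdsWithin_mono w hsub (eventually_isFiveTerm_iff (hsub hw)))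
    (fun _ _ _ _ _ _ h h' => h.trans h') (fun _ _ _ _ h => h.symm)
    (mem_connectedComponentIn hap) hwa
  exact this.1 (isFiveTerm_of_mem_FThatPlus ha)

theorem lift_Lhat_rhoHat (ξ : FreeAbelianGroup FThat) :
    FreeAbelianGroup.lift Lhat (rhoHat ξ) = 0 := by
  have h : (FreeAbelianGroup.lift Lhat).comp rhoHat = 0 := by
    refine FreeAbelianGroup.lift_ext _ _ fun z => ?_
    have h5 := (isFiveTerm_of_mem_FThat z.2).sum_eq_zero
    simp only [Fin.sum_univ_five] at h5
    rw [AddMonoidHom.comp_apply, rhoHat, FreeAbelianGroup.lift_apply_of]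
    simp only [map_add, map_sub, FreeAbelianGroup.lift_apply_of]
    rw [AddMonoidHom.zero_apply, ← h5]
    simp
    abel
  exact DFunLike.congr_fun h ξ

end ExtBloch

/-! ### The lemma: descent to the quotient groups. -/

open ExtBloch
theorem lemma2p1 :
    ∃ Lhat : Cover → ℂ ⧸ Z2,
      (∀ (a : CutPlane) (p q : ℤ), Lhat (Cover.mk a p q) = QuotientAddGroup.mk (Lbar a p q)) ∧
      Cover.IsHolomorphic Lhat ∧
      (∀ z ∈ FThat, ∑ k : Fin 5, (-1 : ℤ) ^ (k : ℕ) • Lhat (z k) = 0) ∧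
      (∃ Φ : PreBlochHat →+ ℂ ⧸ Z2,
        ∀ z : Cover, Φ (QuotientAddGroup.mk (FreeAbelianGroup.of z)) = Lhat z) ∧
      (∃ Ψ : BlochHat →+ ℂ ⧸ Z2,
        ∀ ξ : nuHat.ker, Ψ (QuotientAddGroup.mk ξ) = FreeAbelianGroup.lift Lhat ξ.1) := by
  refine ⟨Lhat, Lhat_mk, isHolomorphic_Lhat, fun z hz => (isFiveTerm_of_mem_FThat hz).sum_eq_zero,
    ⟨QuotientAddGroup.lift _ (FreeAbelianGroup.lift Lhat) ?_, fun z => ?_⟩,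
    ⟨QuotientAddGroup.lift _ ((FreeAbelianGroup.lift Lhat).comp nuHat.ker.subtype) ?_,
      fun ξ => rfl⟩⟩
  · rintro _ ⟨ξ, rfl⟩
    exact lift_Lhat_rhoHat ξ
  · exact FreeAbelianGroup.lift_apply_of _ _
  · rintro ξ ⟨η, hη⟩
    show FreeAbelianGroup.lift Lhat ξ.1 = 0
    rw [show ξ.1 = rhoHat η from hη.symm]
    exact lift_Lhat_rhoHat η
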